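/- Let $q=2^t$ with $t\ge 3$ an integer, and let $n=q^2+1$. For every integer $i$ with $2\le i\le \frac q2-2$ there exists a quantum MDS convolutional code with parameters $[(n,\,n-4i,\,1;\,2,\,2i+3)]_q$, that is, a pure $\mathbb F_{q^2}$-linear convolutional stabilizer code with these parameters whose free distance attains the generalized quantum Singleton bound. Here the terms have the following meaning. *Classical codes.* A polynomial matrix $G(D)=(g_{jl})\in\mathbb F_{q^2}[D]^{\kappa\times n}$ is basic if it has a polynomial right inverse. Its row constraint lengths are $\gamma_j=\max_l\deg g_{jl}$ and its overall constraint length is $\sum_j\gamma_j$. It is reduced basic if it is basic and its overall constraint length is minimal among all basic matrices generating the same code $V=\{u(D)G(D)\}\subseteq\mathbb F_{q^2}[D]^n$. For a reduced basic $G(D)$, $V$ is an $(n,\kappa,\gamma;m)_{q^2}$ convolutional code with degree $\gamma=\sum_j\gamma_j$ and memory $m=\max_j\gamma_j$. *Stabilizer codes.* A convolutional stabilizer code with frame size $n$ and $k$ logical qudits per frame is given by a stabilizer matrix $S(D)=(X(D)\mid Z(D))\in\mathbb F_q[D]^{(n-k)\times 2n}$ of full rank with $X(D)Z(1/D)^{t}-Z(D)X(1/D)^{t}=0$.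 Its memory $m$ is the maximal degree of an entry of $S(D)$. The qudits are arranged in frames of length $n$ indexed by $\mathbb Z$, and the stabilizer is generated, up to phases, by the Pauli operators $X(a)Z(b)$ belonging to the $\mathbb F_q$-multiples $(a\mid b)$ of all $D^j$-shifts, $j\in\mathbb Z$, of the rows of $S(D)$. On one qudit $X(a)|x\rangle=|x+a\rangle$ and $Z(b)|x\rangle=e^{2\pi i\,\mathrm{tr}(bx)/p}|x\rangle$, where $p$ is the characteristic of $\mathbb F_q$ (here $p=2$) and $\mathrm{tr}$ is the trace from $\mathbb F_q$ to $\mathbb F_p$. An error is an infinite tensor product of elements of the group generated by these matrices, with all but finitely many components equal to the identity. Its weight is the number of its non-scalar components. It is detected if it fails to commute with some stabilizer element or lies in the stabilizer up to a scalar. The free distance is the number $d_f$ such that all errors of weight less than $d_f$ are detected and some error of weight $d_f$ is not. The code is pure if its stabilizer contains no non-scalar element of weight less than $d_f$. *Linearity and degree.* The code is $\mathbb F_{q^2}$-linear if, for some normal basis $(\beta,\beta^q)$ of $\mathbb F_{q^2}$ over $\mathbb F_q$, the map $(a\mid b)\mapsto\beta a+\beta^q b$ sends the $\mathbb F_q[D]$-row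 module of $S(D)$ onto an $(n,\frac{n-k}2,\gamma;m)_{q^2}$ convolutional code $V$, where $m$ is the memory of $S(D)$. The degree of the stabilizer code is the degree $\gamma$ of $V$. The parameters are written $[(n,k,m;\gamma,d_f)]_q$. *Bound.* Attaining the generalized quantum Singleton bound means $$d_f=\frac{n-k}{2}\left(\left\lfloor\frac{2\gamma}{n+k}\right\rfloor+1\right)+\gamma+1 .$$ -/

import Mathlib

open Polynomial

namespace QConv

noncomputable section

/-! ### Classical convolutional codes -/

section Classical

variable {K : Type*} [Field K] {k n : ℕ}

/-- The constraint length `γ_i = max_j deg g_{ij}` of the `i`-th row of a polynomial matrix. -/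
def constraintLength {ι : Type*} [Fintype ι] (G : Matrix (Fin k) ι K[X]) (i : Fin k) : ℕ :=
  Finset.univ.sup fun j => (G i j).natDegree

/-- The overall constraint length `∑ γ_i`. -/
def overallConstraintLength {ι : Type*} [Fintype ι] (G : Matrix (Fin k) ι K[X]) : ℕ :=
  ∑ i, constraintLength G i

/-- The memory `max γ_i`. -/
def memory {ι : Type*} [Fintype ι] (G : Matrix (Fin k) ι K[X]) : ℕ :=
  Finset.univ.sup fun i => constraintLength G i

/-- The code `{u(D) G(D)}` generated by `G(D)`, a submodule of `K[D]^n`. -/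
def rowCode (G : Matrix (Fin k) (Fin n) K[X]) : Submodule K[X] (Fin n → K[X]) :=
  LinearMap.range G.vecMulLinear

/-- `G(D)` is basic: it has a polynomial right inverse. -/
def IsBasic (G : Matrix (Fin k) (Fin n) K[X]) : Prop :=
  ∃ R : Matrix (Fin n) (Fin k) K[X], G * R = 1

/-- `G(D)` is a reduced basic matrix: its overall constraint length is smallest
among all basic generator matrices of the same code. -/
def IsReducedBasic (G : Matrix (Fin k) (Fin n) K[X]) : Prop :=
  IsBasic G ∧ ∀ G' : Matrix (Fin k) (Fin n) K[X],
    IsBasic G' → rowCode G' = rowCode G →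
      overallConstraintLength G ≤ overallConstraintLength G'

/-- `V` is a classical convolutional code of length `n`, dimension `k`, degree `γ`
and memory `m`, that is, an `(n, k, γ; m)` code over `K`. -/
def IsConvCode (V : Submodule K[X] (Fin n → K[X])) (k γ m : ℕ) : Prop :=
  ∃ G : Matrix (Fin k) (Fin n) K[X],
    IsReducedBasic G ∧ rowCode G = V ∧ overallConstraintLength G = γ ∧ memory G = m

end Classical

/-! ### Generalized Pauli operators on infinitely many qudits -/

section Pauli

/-- The scalar `∑ₖ b k * x k`. -/
def dot {F ι : Type*} [Field F] (b x : ι →₀ F) : F := b.sum fun k c => c * x k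

theorem dot_neg {F ι : Type*} [Field F] (b x : ι →₀ F) : dot (-b) x = -dot b x := by
  simp [dot, Finsupp.sum, Finset.sum_neg_distrib]


variable (F : Type*) [Field F] [Fintype F]

/-- The additive character `x ↦ w ^ tr x` of `F`, where `w = exp (2πi / p)`, `p` is the
characteristic of `F` and `tr` is the trace from `F` to its prime field. -/
def chi : AddChar F ℂ :=
  haveI : NeZero (ringChar F) := ⟨(CharP.char_is_prime F (ringChar F)).ne_zero⟩
  letI : Algebra (ZMod (ringChar F)) F := ZMod.algebra F (ringChar F)
  (ZMod.stdAddChar (N := ringChar F)).compAddMonoidHom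
    (Algebra.trace (ZMod (ringChar F)) F).toAddMonoidHom

/-- The state space of qudits indexed by `ι`, each with basis `|x⟩`, `x ∈ F`: finite linear
combinations of the basis states `|x⟩ = ⊗ₖ |x k⟩`, where all but finitely many `x k` are `0`
(the direct limit of the finite tensor powers of `ℂ^q` along `v ↦ v ⊗ |0⟩`). -/
abbrev StateSpace (ι : Type*) : Type _ := (ι →₀ F) →₀ ℂ

variable {F} {ι : Type*}

/-- `X(a) = ⊗ₖ X(a k)`, that is, `X(a)|x⟩ = |x + a⟩`. -/
def pauliX (a : ι →₀ F) : StateSpace F ι ≃ₗ[ℂ] StateSpace F ι :=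
  Finsupp.domLCongr (Equiv.addRight a)

/-- The linear map `|x⟩ ↦ w ^ tr (b · x) |x⟩`. -/
def phaseMap (b : ι →₀ F) : StateSpace F ι →ₗ[ℂ] StateSpace F ι :=
  Finsupp.lsum ℂ fun x => chi F (dot b x) • Finsupp.lsingle x

theorem phaseMap_comp (b c : ι →₀ F) (h : ∀ x, dot c x + dot b x = 0) :
    (phaseMap b).comp (phaseMap c) = LinearMap.id := by
  refine Finsupp.lhom_ext fun x z => ?_
  have key : chi F (dot c x) * chi F (dot b x) = 1 := by
    rw [← AddChar.map_add_eq_mul, h x, AddChar.map_zero_eq_one]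
  simp only [phaseMap, LinearMap.comp_apply, Finsupp.lsum_single, LinearMap.smul_apply,
    Finsupp.lsingle_apply, map_smul, smul_smul, key, one_smul, LinearMap.id_apply]

/-- `Z(b) = ⊗ₖ Z(b k)`, that is, `Z(b)|x⟩ = w ^ tr (b · x) |x⟩`. -/
def pauliZ (b : ι →₀ F) : StateSpace F ι ≃ₗ[ℂ] StateSpace F ι :=
  LinearEquiv.ofLinearMap (phaseMap b) (phaseMap (-b))
    (phaseMap_comp _ _ fun x => by rw [dot_neg, neg_add_cancel])
    (phaseMap_comp _ _ fun x => by rw [dot_neg, add_neg_cancel])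

variable (F ι) in
/-- The infinite Pauli group `P_∞`: the group generated by the operators `X(a)` and `Z(b)`
on the single qudits. Its elements are the infinite tensor products of generalized Pauli
matrices with all but finitely many components equal to the identity. -/
def pauliGroup : Subgroup (StateSpace F ι ≃ₗ[ℂ] StateSpace F ι) :=
  Subgroup.closure
    {A | ∃ (k : ι) (a : F), A = pauliX (Finsupp.single k a) ∨ A = pauliZ (Finsupp.single k a)}

/-- The weight of an operator: the number of qudits on which it acts nontrivially. An operator
acts trivially on qudit `k` (it has the tensor component `I` there, up to a scalar) iff it
commutes with all Pauli operators on this qudit. -/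
def weight (A : StateSpace F ι ≃ₗ[ℂ] StateSpace F ι) : ℕ :=
  Set.ncard {k : ι | ¬ ∀ a : F,
    Commute A (pauliX (Finsupp.single k a)) ∧ Commute A (pauliZ (Finsupp.single k a))}

/-- The error `E` is detected by the stabilizer `S`: it does not commute with some stabilizer
element, or it belongs to the stabilizer up to a scalar (and thus acts as a scalar on the code). -/
def Detects (S : Subgroup (StateSpace F ι ≃ₗ[ℂ] StateSpace F ι))
    (E : StateSpace F ι ≃ₗ[ℂ] StateSpace F ι) : Prop :=
  (∃ A ∈ S, ¬ Commute E A) ∨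
    ∃ A ∈ S, ∃ c : ℂ, (E : StateSpace F ι →ₗ[ℂ] StateSpace F ι) = c • A.toLinearMap

/-- The code with stabilizer `S` has free distance `d`: it detects all errors of weight less
than `d` and does not detect some error of weight `d`. -/
def HasFreeDistance (S : Subgroup (StateSpace F ι ≃ₗ[ℂ] StateSpace F ι)) (d : ℕ) : Prop :=
  (∀ E ∈ pauliGroup F ι, weight E < d → Detects S E) ∧
    ∃ E ∈ pauliGroup F ι, weight E = d ∧ ¬ Detects S E

/-- The code with stabilizer `S` and free distance `d` is pure: apart from scalars, the
stabilizer contains no errors of weight less than `d`. -/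
def IsPure (S : Subgroup (StateSpace F ι ≃ₗ[ℂ] StateSpace F ι)) (d : ℕ) : Prop :=
  ∀ A ∈ S, weight A ≠ 0 → d ≤ weight A

end Pauli

/-! ### Convolutional stabilizer codes -/

section Quantum

variable {F : Type*} [Field F] {r n : ℕ}

/-- A polynomial vector `f(D) = ∑ₛ fₛ D^s` shifted by `j` frames, as a stream of frames of
length `n` indexed by `ℤ`: the frame number `j + s` is `fₛ`. -/
def stream (j : ℤ) (f : Fin n → F[X]) : ℤ × Fin n →₀ F :=
  ∑ l, ∑ s ∈ (f l).support, Finsupp.single (j + (s : ℤ), l) ((f l).coeff s)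

/-- `S(D) = (X(D) | Z(D))` is a stabilizer matrix: it has full rank and satisfies
`X(D) Z(1/D)ᵗ - Z(D) X(1/D)ᵗ = 0`. -/
def IsStabilizerMatrix (S : Matrix (Fin r) (Fin n ⊕ Fin n) F[X]) : Prop :=
  LinearIndependent F[X] S.row ∧
    S.toCols₁.map toLaurent * (S.toCols₂.map fun f => LaurentPolynomial.invert (toLaurent f)).transpose
      - S.toCols₂.map toLaurent *
        (S.toCols₁.map fun f => LaurentPolynomial.invert (toLaurent f)).transpose = 0

/-- The stabilizer (up to phases, which do not affect which errors are detected) defined by the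
stabilizer matrix `S(D)`: it is generated by the Pauli operators `X(a) Z(b)`, where `(a | b)`
runs through the `F`-multiples of the rows of `S(D)`, shifted by all numbers of frames. -/
def stabilizer [Fintype F] (S : Matrix (Fin r) (Fin n ⊕ Fin n) F[X]) :
    Subgroup (StateSpace F (ℤ × Fin n) ≃ₗ[ℂ] StateSpace F (ℤ × Fin n)) :=
  Subgroup.closure {A | ∃ (j : ℤ) (i : Fin r) (c : F),
    A = pauliX (c • stream j (S.toCols₁ i)) * pauliZ (c • stream j (S.toCols₂ i))}

/-- The vector `β a(D) + β^q b(D)` over `K = F_{q²}` associated with the vector `(a(D) | b(D))`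
over `F = F_q`. -/
def combine {K : Type*} [Field K] [Algebra F K] [Fintype F] (β : K)
    (f : Fin n ⊕ Fin n → F[X]) : Fin n → K[X] :=
  fun l => C β * (f (Sum.inl l)).map (algebraMap F K) +
    C (β ^ Fintype.card F) * (f (Sum.inr l)).map (algebraMap F K)

/-- The stabilizer matrix `S(D)` over `F = F_q` defines an `F_{q²}`-linear `[(n, k, m; γ, d)]_q`
convolutional stabilizer code, where `K = F_{q²}`. Here `n` is the frame size, `k` the number of
logical qudits per frame, `m` the memory, `d` the free distance. The code is `F_{q²}`-linear: for
a normal basis `(β, β^q)` of `K` over `F` the map `(a | b) ↦ β a + β^q b` sends the row module of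
`S(D)` to a classical convolutional code `V` over `K`, and `γ` is the degree of `V`. -/
structure IsLinearStabilizerCode (K : Type*) [Field K] [Algebra F K] [Fintype F]
    (S : Matrix (Fin r) (Fin n ⊕ Fin n) F[X]) (k m γ d : ℕ) : Prop where
  rate : r + k = n
  stabilizerMatrix : IsStabilizerMatrix S
  memory_eq : memory S = m
  linear : ∃ β : K, LinearIndependent F ![β, β ^ Fintype.card F] ∧
    ∃ (κ : ℕ) (V : Submodule K[X] (Fin n → K[X])),
      2 * κ = r ∧ IsConvCode V κ γ m ∧
        (V : Set (Fin n → K[X])) = {v | ∃ u : Fin r → F[X], v = combine β (Matrix.vecMul u S)}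
  freeDistance : HasFreeDistance (stabilizer S) d

/-- The right-hand side of the generalized quantum Singleton bound for pure `F_{q²}`-linear
`[(n, k, m; γ, d)]_q` convolutional stabilizer codes. -/
def singletonBound (n k γ : ℕ) : ℚ :=
  ((n : ℚ) - k) / 2 * (⌊2 * (γ : ℚ) / (n + k)⌋ + 1) + γ + 1

/-- `S(D)` defines a quantum MDS convolutional code with parameters `[(n, k, m; γ, d)]_q`: a pure
`F_{q²}`-linear convolutional stabilizer code attaining the generalized quantum Singleton bound. -/
def IsMDSCode (K : Type*) [Field K] [Algebra F K] [Fintype F]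
    (S : Matrix (Fin r) (Fin n ⊕ Fin n) F[X]) (k m γ d : ℕ) : Prop :=
  IsLinearStabilizerCode K S k m γ d ∧ IsPure (stabilizer S) d ∧ (d : ℚ) = singletonBound n k γ

end Quantum

end

end QConv

/-! Evaluate forms of degree `q - 1` at the `q² + 1` points of the projective line over `K =
F_{q²}`. The resulting Reed-Solomon code is Hermitian self-orthogonal
(`sum_projEval_mul_pow_eq_zero`), so every subcode is too. A nonzero form has at most `q - 1` zeros,
so a nonzero codeword has weight at least `q² + 2 - q`, far above `2i + 3`.

Let `p` be a quadratic without roots and `q = 2e + 2i + 2`. The rows of `A` are the values of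
`p^(e+1) X^r` for `r < 2i`; two further rows `B` extend them to a basis of the values of `p^e f`,
`deg f ≤ 2i + 1`. Since `p` vanishes at no point, multiplying by a power of `p` only rescales
coordinates. Hence the duals of `A` and of `(A, B)` are MDS, with distances `2i + 1` and `2i + 3`.
Moreover `B` is chosen to have no zero column.

The convolutional code is generated by `A + D B`, with `B` padded by zero rows. It has memory 1 and
degree 2, the degree being minimal because the rows of `A` and `B` together are independent. A
finite stream orthogonal to all shifts satisfies `A u = 0` in its last frame and `B u = 0` in its
first. If these frames differ, the weight is at least `(2i + 1) + 2`; if they agree, the single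
frame lies in the dual of `(A, B)`. Either way it is at least `2i + 3`, and a dual word of `(A, B)`
placed in one frame attains this value.

To pass to qudits, each row is multiplied by `β` and by `β^q` and expanded in this normal basis. The
symplectic form is, up to the factor `β² - β^(2q)`, the skew part of the Hermitian form
(`algebraMap_symplectic`). So self-orthogonality gives the stabilizer condition, and the errors
commuting with the stabilizer are the conjugates of the dual streams. Every frame of a stabilizer
element lies in the self-orthogonal code, which gives purity and shows that the error of weight `2i
+ 3` is not in the stabilizer. -/

namespace QConv
noncomputable section
-- Pauli operators and their labels `(a | b)`
section PauliCalculus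

variable {F : Type*} [Field F] {ι : Type*}

theorem dot_add_right (b x y : ι →₀ F) : dot b (x + y) = dot b x + dot b y := by
  simp [dot, Finsupp.sum, mul_add, Finset.sum_add_distrib]

theorem dot_zero_right (b : ι →₀ F) : dot b 0 = 0 := by simp [dot]

theorem dot_zero_left (b : ι →₀ F) : dot 0 b = 0 := by simp [dot]

theorem dot_add_left (b c x : ι →₀ F) : dot (b + c) x = dot b x + dot c x := by
  classical
  exact Finsupp.sum_add_index (by simp) (by intros; ring)

theorem dot_single_right (b : ι →₀ F) (k : ι) (c : F) : dot b (Finsupp.single k c) = b k * c := by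
  classical
  simp only [dot, Finsupp.sum, Finsupp.single_apply, mul_ite, mul_zero]
  rw [Finset.sum_ite_eq]
  split_ifs with h
  · rfl
  · simp [Finsupp.notMem_support_iff.1 h]

theorem dot_single_left (x : ι →₀ F) (k : ι) (c : F) : dot (Finsupp.single k c) x = c * x k := by
  simp [dot]

theorem dot_smul_left (c : F) (b x : ι →₀ F) : dot (c • b) x = c * dot b x := by
  rw [dot, Finsupp.sum_smul_index (by simp), dot, Finsupp.mul_sum]
  simp [mul_assoc]

theorem dot_smul_right (c : F) (b x : ι →₀ F) : dot b (c • x) = c * dot b x := by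
  simp [dot, Finsupp.mul_sum, mul_left_comm]

theorem dot_sum_right {κ : Type*} (b : ι →₀ F) (s : Finset κ) (f : κ → ι →₀ F) :
    dot b (∑ k ∈ s, f k) = ∑ k ∈ s, dot b (f k) := by
  classical
  induction s using Finset.induction_on with
  | empty => simp [dot_zero_right]
  | insert a s ha ih => rw [Finset.sum_insert ha, Finset.sum_insert ha, dot_add_right, ih]

theorem dot_comm (b x : ι →₀ F) : dot b x = dot x b := by
  induction x using Finsupp.induction_linear with
  | zero => rw [dot_zero_left, dot_zero_right]
  | add f g hf hg => rw [dot_add_right, dot_add_left, hf, hg]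
  | single k c => rw [dot_single_left, dot_single_right, mul_comm]

variable [Fintype F]

/-- The trace is onto the prime field and the standard character is injective there, so for `s ≠ 0`
some multiple of `s` has trace 1 and a nontrivial phase. -/
theorem eq_zero_of_chi_mul_eq_one (s : F) (h : ∀ c : F, chi F (c * s) = 1) : s = 0 := by
  by_contra hs
  have : Fact (ringChar F).Prime := ⟨CharP.char_is_prime F (ringChar F)⟩
  let _ : Algebra (ZMod (ringChar F)) F := ZMod.algebra F (ringChar F)
  obtain ⟨y, hy⟩ := Algebra.trace_surjective (ZMod (ringChar F)) F 1
  have h1 := h (y * s⁻¹)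
  rw [inv_mul_cancel_right₀ hs] at h1
  have h2 : (ZMod.stdAddChar (N := ringChar F)) (Algebra.trace (ZMod (ringChar F)) F y) = 1 := h1
  rw [hy, ← AddChar.map_zero_eq_one (ZMod.stdAddChar (N := ringChar F))] at h2
  exact one_ne_zero (ZMod.injective_stdAddChar h2)

omit [Fintype F] in
@[simp] theorem pauliX_single (a x : ι →₀ F) (z : ℂ) :
    pauliX a (Finsupp.single x z) = Finsupp.single (x + a) z := by
  simp [pauliX]

@[simp] theorem pauliZ_single (b x : ι →₀ F) (z : ℂ) :
    pauliZ b (Finsupp.single x z) = Finsupp.single x (chi F (dot b x) * z) := by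
  change phaseMap b _ = _
  simp [phaseMap]

/-- The operator `A` is a nonzero scalar multiple of `X(a) Z(b)`. -/
def IsPauli (A : StateSpace F ι ≃ₗ[ℂ] StateSpace F ι) (a b : ι →₀ F) : Prop :=
  ∃ c : ℂ, c ≠ 0 ∧ ∀ x z, A (Finsupp.single x z) = Finsupp.single (x + a) (c * chi F (dot b x) * z)

theorem isPauli_one : IsPauli (1 : StateSpace F ι ≃ₗ[ℂ] StateSpace F ι) 0 0 :=
  ⟨1, one_ne_zero, fun x z => by simp [dot_zero_left]⟩

theorem isPauli_pauliX (a : ι →₀ F) : IsPauli (pauliX a) a 0 :=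
  ⟨1, one_ne_zero, fun x z => by simp [dot_zero_left]⟩

theorem isPauli_pauliZ (b : ι →₀ F) : IsPauli (pauliZ b) 0 b :=
  ⟨1, one_ne_zero, fun x z => by simp⟩

theorem chi_ne_zero (s : F) : chi F s ≠ 0 := fun h => by
  have := AddChar.map_add_eq_mul (chi F) s (-s)
  rw [h, add_neg_cancel, AddChar.map_zero_eq_one, zero_mul] at this
  exact one_ne_zero this

theorem IsPauli.mul {A B : StateSpace F ι ≃ₗ[ℂ] StateSpace F ι} {a b a' b' : ι →₀ F}
    (hA : IsPauli A a b) (hB : IsPauli B a' b') : IsPauli (A * B) (a + a') (b + b') := by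
  obtain ⟨c, hc, hA⟩ := hA
  obtain ⟨c', hc', hB⟩ := hB
  refine ⟨c * c' * chi F (dot b a'), mul_ne_zero (mul_ne_zero hc hc') (chi_ne_zero _), ?_⟩
  intro x z
  rw [LinearEquiv.mul_apply, hB, hA, dot_add_right, dot_add_left, AddChar.map_add_eq_mul,
    AddChar.map_add_eq_mul]
  congr 1
  · abel
  · ring

theorem IsPauli.inv {A : StateSpace F ι ≃ₗ[ℂ] StateSpace F ι} {a b : ι →₀ F}
    (hA : IsPauli A a b) : IsPauli A⁻¹ (-a) (-b) := by
  obtain ⟨c, hc, hA⟩ := hA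
  refine ⟨c⁻¹ * chi F (dot b a), mul_ne_zero (inv_ne_zero hc) (chi_ne_zero _), ?_⟩
  intro x z
  apply A.injective
  have h1 : A (A⁻¹ (Finsupp.single x z)) = Finsupp.single x z := A.apply_symm_apply _
  rw [h1, hA]
  have e : dot b (x + -a) = dot b x - dot b a := by
    rw [dot_add_right, dot_comm b (-a), dot_neg, dot_comm a, sub_eq_add_neg]
  rw [e, dot_neg]
  have e2 : chi F (dot b x - dot b a) * chi F (dot b a) * chi F (-dot b x) = 1 := by
    rw [← AddChar.map_add_eq_mul, ← AddChar.map_add_eq_mul, ← AddChar.map_zero_eq_one (chi F)]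
    congr 1; ring
  congr 1
  · abel
  · linear_combination (-z) * e2 - z * chi F (dot b x - dot b a) * chi F (dot b a) *
      chi F (-dot b x) * mul_inv_cancel₀ hc

/-- Both products send `|x⟩` to a multiple of `|x + a + a'⟩`; the two phases differ by a factor
independent of `x`. -/
theorem IsPauli.commute_iff {A B : StateSpace F ι ≃ₗ[ℂ] StateSpace F ι} {a b a' b' : ι →₀ F}
    (hA : IsPauli A a b) (hB : IsPauli B a' b') :
    Commute A B ↔ chi F (dot b a' - dot b' a) = 1 := by
  obtain ⟨c, hc, hA⟩ := hA
  obtain ⟨c', hc', hB⟩ := hB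
  have hAB : ∀ x z, (A * B) (Finsupp.single x z) = Finsupp.single (x + a + a')
      (c * c' * chi F (dot b x) * chi F (dot b' x) * chi F (dot b a') * z) := by
    intro x z
    rw [LinearEquiv.mul_apply, hB, hA, dot_add_right, AddChar.map_add_eq_mul]
    congr 1
    · abel
    · ring
  have hBA : ∀ x z, (B * A) (Finsupp.single x z) = Finsupp.single (x + a + a')
      (c * c' * chi F (dot b x) * chi F (dot b' x) * chi F (dot b' a) * z) := by
    intro x z
    rw [LinearEquiv.mul_apply, hA, hB, dot_add_right, AddChar.map_add_eq_mul]
    congr 1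
    ring
  have key : chi F (dot b a' - dot b' a) = 1 ↔ chi F (dot b a') = chi F (dot b' a) := by
    have : chi F (dot b a') = chi F (dot b a' - dot b' a) * chi F (dot b' a) := by
      rw [← AddChar.map_add_eq_mul, sub_add_cancel]
    rw [this]
    exact ⟨fun h => by rw [h, one_mul], fun h => mul_right_cancel₀ (chi_ne_zero _) (by rw [h, one_mul])⟩
  rw [key]
  constructor
  · intro h
    have h1 := hAB 0 1
    rw [h.eq, hBA 0 1] at h1
    have h2 := Finsupp.single_injective _ h1
    simp only [dot_zero_right, AddChar.map_zero_eq_one, mul_one] at h2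
    exact (mul_left_cancel₀ (mul_ne_zero hc hc') h2).symm
  · intro h
    apply LinearEquiv.toLinearMap_injective
    refine Finsupp.lhom_ext fun x z => ?_
    change (A * B) _ = (B * A) _
    rw [hAB, hBA, h]

/-- Commuting with all `Z(c)` on qudit `k` forces `a k = 0`, commuting with all `X(c)` forces `b k =
0`. -/
theorem IsPauli.weight_eq {A : StateSpace F ι ≃ₗ[ℂ] StateSpace F ι} {a b : ι →₀ F}
    (hA : IsPauli A a b) : weight A = Set.ncard {k : ι | a k ≠ 0 ∨ b k ≠ 0} := by
  unfold weight
  congr 1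
  ext k
  simp only [Set.mem_ofPred_eq]
  rw [← not_iff_not, not_not]
  push Not
  constructor
  · intro h
    constructor
    · refine eq_zero_of_chi_mul_eq_one _ fun c => ?_
      have := (hA.commute_iff (isPauli_pauliZ _)).1 (h (-c)).2
      rwa [dot_zero_right, dot_single_left, zero_sub, neg_mul, neg_neg] at this
    · refine eq_zero_of_chi_mul_eq_one _ fun c => ?_
      have := (hA.commute_iff (isPauli_pauliX _)).1 (h c).1
      rwa [dot_zero_left, dot_single_right, sub_zero, mul_comm] at this
  · rintro ⟨h1, h2⟩ c
    constructor
    · rw [hA.commute_iff (isPauli_pauliX _), dot_zero_left, dot_single_right, h2]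
      simp
    · rw [hA.commute_iff (isPauli_pauliZ _), dot_zero_right, dot_single_left, h1]
      simp

theorem exists_isPauli_of_mem_pauliGroup {A : StateSpace F ι ≃ₗ[ℂ] StateSpace F ι}
    (hA : A ∈ pauliGroup F ι) : ∃ a b, IsPauli A a b := by
  induction hA using Subgroup.closure_induction with
  | mem x hx =>
    obtain ⟨k, a, rfl | rfl⟩ := hx
    exacts [⟨_, _, isPauli_pauliX _⟩, ⟨_, _, isPauli_pauliZ _⟩]
  | one => exact ⟨_, _, isPauli_one⟩
  | mul x y _ _ hx hy =>
    obtain ⟨a, b, h⟩ := hx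
    obtain ⟨a', b', h'⟩ := hy
    exact ⟨_, _, h.mul h'⟩
  | inv x _ hx =>
    obtain ⟨a, b, h⟩ := hx
    exact ⟨_, _, h.inv⟩

omit [Fintype F] in
theorem pauliX_add (a b : ι →₀ F) : (pauliX (a + b)) = pauliX a * pauliX b := by
  apply LinearEquiv.toLinearMap_injective
  refine Finsupp.lhom_ext fun x z => ?_
  change pauliX (a + b) _ = pauliX a (pauliX b _)
  simp only [pauliX_single]
  congr 1
  abel

theorem pauliZ_add (a b : ι →₀ F) : (pauliZ (a + b)) = pauliZ a * pauliZ b := by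
  apply LinearEquiv.toLinearMap_injective
  refine Finsupp.lhom_ext fun x z => ?_
  change pauliZ (a + b) _ = pauliZ a (pauliZ b _)
  simp only [pauliZ_single, dot_add_left, AddChar.map_add_eq_mul]
  congr 1
  ring

theorem pauliX_mem (a : ι →₀ F) : pauliX a ∈ pauliGroup F ι := by
  induction a using Finsupp.induction_linear with
  | zero =>
    convert one_mem (pauliGroup F ι)
    apply LinearEquiv.toLinearMap_injective
    refine Finsupp.lhom_ext fun x z => ?_
    change pauliX 0 _ = _
    simp
  | add f g hf hg => rw [pauliX_add]; exact mul_mem hf hg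
  | single k c => exact Subgroup.subset_closure ⟨k, c, Or.inl rfl⟩

theorem pauliZ_mem (a : ι →₀ F) : pauliZ a ∈ pauliGroup F ι := by
  induction a using Finsupp.induction_linear with
  | zero =>
    convert one_mem (pauliGroup F ι)
    apply LinearEquiv.toLinearMap_injective
    refine Finsupp.lhom_ext fun x z => ?_
    change pauliZ 0 _ = _
    simp [dot_zero_left]
  | add f g hf hg => rw [pauliZ_add]; exact mul_mem hf hg
  | single k c => exact Subgroup.subset_closure ⟨k, c, Or.inr rfl⟩

theorem isPauli_mul (a b : ι →₀ F) : IsPauli (pauliX a * pauliZ b) a b := by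
  simpa using (isPauli_pauliX a).mul (isPauli_pauliZ b)

/-- Proportional Pauli operators have the same label. -/
theorem IsPauli.eq_of_eq_smul {A B : StateSpace F ι ≃ₗ[ℂ] StateSpace F ι} {a b a' b' : ι →₀ F}
    (hA : IsPauli A a b) (hB : IsPauli B a' b') {c : ℂ}
    (h : (A : StateSpace F ι →ₗ[ℂ] StateSpace F ι) = c • B.toLinearMap) : a = a' ∧ b = b' := by
  obtain ⟨d, hd, hA⟩ := hA
  obtain ⟨d', hd', hB⟩ := hB
  have h1 : ∀ x, Finsupp.single (x + a) (d * chi F (dot b x)) =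
      Finsupp.single (x + a') (c * (d' * chi F (dot b' x))) := by
    intro x
    have h2 : A (Finsupp.single x 1) = c • B (Finsupp.single x 1) := DFunLike.congr_fun h _
    rw [hA, hB] at h2
    simpa only [mul_one, Finsupp.smul_single, smul_eq_mul] using h2
  have ha : a = a' := by
    have h2 := h1 0
    rw [Finsupp.single_eq_single_iff] at h2
    rcases h2 with h2 | h2
    · simpa using h2.1
    · exact absurd h2.1 (mul_ne_zero hd (chi_ne_zero _))
  subst ha
  refine ⟨rfl, ?_⟩
  have h2 : ∀ x, d * chi F (dot b x) = c * (d' * chi F (dot b' x)) :=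
    fun x => Finsupp.single_injective _ (h1 x)
  have h3 : d = c * d' := by simpa [dot_zero_right] using h2 0
  ext k
  rw [← sub_eq_zero]
  refine eq_zero_of_chi_mul_eq_one _ fun s => ?_
  have h4 := h2 (Finsupp.single k s)
  rw [dot_single_right, dot_single_right, ← mul_assoc, ← h3] at h4
  have h5 := mul_left_cancel₀ hd h4
  apply mul_right_cancel₀ (chi_ne_zero (b' k * s))
  rw [← AddChar.map_add_eq_mul, one_mul, ← h5]
  congr 1
  ring

theorem IsPauli.eq_smul_one {A : StateSpace F ι ≃ₗ[ℂ] StateSpace F ι} (hA : IsPauli A 0 0) :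
    ∃ c : ℂ, (A : StateSpace F ι →ₗ[ℂ] StateSpace F ι) =
      c • (1 : StateSpace F ι ≃ₗ[ℂ] StateSpace F ι).toLinearMap := by
  obtain ⟨d, hd, hA⟩ := hA
  refine ⟨d, Finsupp.lhom_ext fun x z => ?_⟩
  change A _ = d • Finsupp.single x z
  rw [hA]
  simp [dot_zero_left]

end PauliCalculus
-- Evaluation codes on the projective line
section ProjectiveLine

variable {K : Type*} [Field K]

/-- The values of `f`, as a form of degree `D`, at the points of the projective line; `none` is
the point at infinity. -/
def projEval (D : ℕ) : K[X] →ₗ[K] (Option K → K) where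
  toFun f P := P.elim (f.coeff D) (fun x => f.eval x)
  map_add' f g := by ext (_ | _) <;> simp
  map_smul' c f := by ext (_ | _) <;> simp

@[simp] theorem projEval_none (D : ℕ) (f : K[X]) : projEval D f none = f.coeff D := rfl

@[simp] theorem projEval_some (D : ℕ) (f : K[X]) (x : K) : projEval D f (some x) = f.eval x := rfl

/-- There is a vector of weight at most `m + 1` orthogonal to `m` given vectors. -/
theorem exists_orthogonal_of_card_lt {κ ι : Type*} [Fintype κ] [Fintype ι] (A : κ → ι → K)
    (h : Fintype.card κ < Fintype.card ι) :
    ∃ u : ι → K, u ≠ 0 ∧ (Function.support u).ncard ≤ Fintype.card κ + 1 ∧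
      ∀ r, ∑ l, A r l * u l = 0 := by
  classical
  obtain ⟨T, -, hT⟩ := Finset.exists_subset_card_eq (s := (Finset.univ : Finset ι))
    (n := Fintype.card κ + 1) (by rw [Finset.card_univ]; omega)
  let φ : (T → K) →ₗ[K] (κ → K) := (Matrix.of fun r (l : T) => A r l).mulVecLin
  have hφ : φ.ker ≠ ⊥ := by
    apply LinearMap.ker_ne_bot_of_finrank_lt
    rw [Module.finrank_fintype_fun_eq_card, Module.finrank_fintype_fun_eq_card,
      Fintype.card_coe, hT]
    omega
  obtain ⟨v, hv, hv0⟩ := Submodule.exists_mem_ne_zero_of_ne_bot hφ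
  refine ⟨fun l => if hl : l ∈ T then v ⟨l, hl⟩ else 0, ?_, ?_, ?_⟩
  · obtain ⟨l, hl⟩ := Function.ne_iff.1 hv0
    refine Function.ne_iff.2 ⟨l, ?_⟩
    simpa using hl
  · rw [← hT, ← Set.ncard_coe_finset]
    refine Set.ncard_le_ncard fun l hl => ?_
    by_contra hlT
    rw [Function.mem_support] at hl
    exact hl (dif_neg hlT)
  · intro r
    have h1 := congrFun (LinearMap.mem_ker.1 hv) r
    simp only [φ, Matrix.mulVecLin_apply, Matrix.mulVec, dotProduct, Matrix.of_apply,
      Pi.zero_apply] at h1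
    refine Eq.trans ?_ h1
    rw [← Finset.sum_subset (Finset.subset_univ T), ← Finset.sum_coe_sort T]
    · refine Finset.sum_congr rfl fun l _ => ?_
      simp
    · intro l _ hl
      simp [hl]

open Matrix in
/-- `W` is a code of length `|ι|` that is self-orthogonal for the Hermitian form and has large
minimum distance; the rows of `A` and `B` lie in `W`, and the codes with parity check matrices
`A` and `(A, B)` have minimum distance at least `2i + 1` and `2i + 3`. -/
structure SelfOrthogonalRows {ι : Type*} [Fintype ι] (q i : ℕ) (W : Submodule K (ι → K))
    (A : Matrix (Fin (2 * i)) ι K) (B : Matrix (Fin 2) ι K) : Prop where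
  left_mem : ∀ r, A r ∈ W
  right_mem : ∀ r, B r ∈ W
  linearIndependent : LinearIndependent K (Sum.elim A B)
  selfOrthogonal : ∀ w ∈ W, ∀ w' ∈ W, ∑ P, w P * w' P ^ q = 0
  distance : ∀ w ∈ W, w ≠ 0 → q ^ 2 + 2 ≤ (Function.support w).ncard + q
  left_dual : ∀ u, u ≠ 0 → (∀ r, A r ⬝ᵥ u = 0) → 2 * i < (Function.support u).ncard
  dual : ∀ u, u ≠ 0 → (∀ r, A r ⬝ᵥ u = 0) → (∀ r, B r ⬝ᵥ u = 0) →
    2 * i + 2 < (Function.support u).ncard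
  right_ne_zero : ∀ P, ∃ r, B r P ≠ 0

variable [Fintype K]

/-- A zero at infinity means that the degree drops below `D`, which leaves room for at most `D - 1`
finite zeros. -/
theorem ncard_zeros_projEval_le {D : ℕ} {f : K[X]} (hf : f ≠ 0) (hD : f.natDegree ≤ D) :
    {P | projEval D f P = 0}.ncard ≤ D := by
  classical
  have hr : f.roots.toFinset.card ≤ f.natDegree :=
    (Multiset.toFinset_card_le _).trans (card_roots' f)
  by_cases h : f.coeff D = 0
  · have hlt : f.natDegree < D := lt_of_le_of_ne hD fun e => by
      rw [← e] at h
      exact hf (leadingCoeff_eq_zero.1 h)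
    have hsub : {P | projEval D f P = 0} ⊆ ((insert none (f.roots.toFinset.map .some) : Finset (Option K)) : Set (Option K)) := by
      rintro (_ | x) hx
      · simp
      · simpa [hf] using hx
    refine (Set.ncard_le_ncard hsub).trans ?_
    rw [Set.ncard_coe_finset]
    refine (Finset.card_insert_le _ _).trans ?_
    rw [Finset.card_map]
    omega
  · have hsub : {P | projEval D f P = 0} ⊆ ((f.roots.toFinset.map .some : Finset (Option K)) : Set (Option K)) := by
      rintro (_ | x) hx
      · exact absurd hx h
      · simpa [hf] using hx
    refine (Set.ncard_le_ncard hsub).trans ?_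
    rw [Set.ncard_coe_finset, Finset.card_map]
    omega

theorem le_ncard_support_projEval {D : ℕ} {f : K[X]} (hf : f ≠ 0) (hD : f.natDegree ≤ D) :
    Fintype.card K + 1 ≤ (Function.support (projEval D f)).ncard + D := by
  have h := Set.ncard_add_ncard_compl {P | projEval D f P = 0}
  have h2 := ncard_zeros_projEval_le hf hD
  have e : {P | projEval D f P = 0}ᶜ = Function.support (projEval D f) := by ext; simp
  rw [e, Nat.card_eq_fintype_card, Fintype.card_option] at h
  omega

/-- A nonzero vector orthogonal to all multiples of `g` of degree at most `D` has weight at least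
`D - deg g + 2`. -/
theorem lt_ncard_support_of_orthogonal {D m : ℕ} {g : K[X]} (hg : ∀ x, g.eval x ≠ 0)
    (hm : g.natDegree + m = D + 1) (u : Option K → K) (hu : u ≠ 0)
    (h : ∀ f : K[X], f.natDegree < m → ∑ P, projEval D (g * f) P * u P = 0) :
    m < (Function.support u).ncard := by
  classical
  have hg0 : g ≠ 0 := by rintro rfl; exact hg 0 (by simp)
  by_contra! hcard
  rw [Set.ncard_eq_toFinset_card'] at hcard
  set S := (Function.support u).toFinset with hS
  have hmemS : ∀ P, P ∈ S ↔ u P ≠ 0 := fun P => by simp [hS]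
  obtain ⟨P0, hP0⟩ := Function.ne_iff.1 hu
  have hP0S : P0 ∈ S := (hmemS P0).2 hP0
  have hm0 : 0 < m := lt_of_lt_of_le (Finset.card_pos.2 ⟨P0, hP0S⟩) hcard
  have hTe := Finset.card_erase_of_mem hP0S
  -- If `u` had weight at most `m`, a form of degree `m - 1` could vanish at all points of its
  -- support except `P0`. Pairing `u` with `g` times this form would leave one nonzero term.
  set T : Finset K := (S.erase P0).eraseNone with hT
  have hmemT : ∀ x, x ∈ T ↔ some x ≠ P0 ∧ u (some x) ≠ 0 := fun x => by simp [hT, hmemS]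
  have hTcard : T.card ≤ (S.erase P0).card := by
    rw [hT, ← Finset.card_map, Finset.map_some_eraseNone]
    exact Finset.card_erase_le
  set N : K[X] := ∏ x ∈ T, (X - C x) with hN
  have hNm : N.Monic := monic_prod_of_monic _ _ fun x _ => monic_X_sub_C x
  have hNd : N.natDegree = T.card := by
    rw [hN, natDegree_prod_of_monic _ _ fun x _ => monic_X_sub_C x]; simp
  have hNe : ∀ x, N.eval x = 0 ↔ x ∈ T := fun x => by
    rw [hN, eval_prod, Finset.prod_eq_zero_iff]
    simp [sub_eq_zero]
  rcases P0 with _ | x0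
  -- For `P0` at infinity the degree is padded to exactly `m - 1`, so that the coefficient at `D` is
  -- the leading coefficient of `g`.
  · have hd : (N * X ^ (m - 1 - T.card)).natDegree = m - 1 := by
      rw [hNm.natDegree_mul (monic_X_pow _), hNd, natDegree_X_pow]; omega
    have h1 := h (N * X ^ (m - 1 - T.card)) (by omega)
    rw [Fintype.sum_option, Finset.sum_eq_zero, add_zero, projEval_none] at h1
    · have h2 : (g * (N * X ^ (m - 1 - T.card))).coeff D = g.leadingCoeff := by
        have e1 : D = g.natDegree + (m - 1) := by omega
        have e2 := (hNm.mul (monic_X_pow (m - 1 - T.card))).coeff_natDegree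
        rw [hd] at e2
        rw [e1, coeff_mul_add_eq_of_natDegree_le le_rfl hd.le, e2, mul_one, leadingCoeff]
      rw [h2] at h1
      exact mul_ne_zero (leadingCoeff_ne_zero.2 hg0) hP0 h1
    · intro x _
      by_cases hx : u (some x) = 0
      · rw [hx, mul_zero]
      · have := (hNe x).2 ((hmemT x).2 ⟨by simp, hx⟩)
        simp [this]
  · have h1 := h N (by omega)
    rw [Fintype.sum_option, Finset.sum_eq_single x0] at h1
    · have h0 : projEval D (g * N) none * u none = 0 := by
        by_cases hn : u none = 0
        · rw [hn, mul_zero]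
        -- If infinity lies in the support it is not counted in `T`; the degree is then at most `m -
        -- 2`, which gives the required zero at infinity.
        · have hlt : T.card < (S.erase (some x0)).card := by
            have hmem : none ∈ S.erase (some x0) := by
              rw [Finset.mem_erase]; exact ⟨by simp, (hmemS none).2 hn⟩
            rw [hT, ← Finset.card_map, Finset.map_some_eraseNone, Finset.card_erase_of_mem hmem]
            exact Nat.sub_lt (Finset.card_pos.2 ⟨_, hmem⟩) one_pos
          rw [projEval_none, coeff_eq_zero_of_natDegree_lt, zero_mul]
          have := natDegree_mul_le (p := g) (q := N)
          omega
      rw [h0, zero_add, projEval_some, eval_mul] at h1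
      refine mul_ne_zero (mul_ne_zero (hg x0) ?_) hP0 h1
      intro h2
      exact ((hmemT x0).1 ((hNe x0).1 h2)).1 rfl
    · intro x _ hx
      by_cases hx' : u (some x) = 0
      · rw [hx', mul_zero]
      · have := (hNe x).2 ((hmemT x).2 ⟨by simpa using hx, hx'⟩)
        simp [this]
    · simp

/-- The power sums over `K` with exponent below `|K| - 1` vanish, and the one with exponent `|K| -
1` is `-1`. -/
theorem sum_eval_eq_neg_coeff (h : K[X]) (hd : h.natDegree ≤ Fintype.card K - 1) :
    ∑ x, h.eval x = - h.coeff (Fintype.card K - 1) := by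
  have hq : 1 < Fintype.card K := Fintype.one_lt_card
  have h1 : ∀ x, h.eval x = ∑ k ∈ Finset.range (Fintype.card K), h.coeff k * x ^ k := fun x =>
    eval_eq_sum_range' (by omega) x
  simp_rw [h1]
  rw [Finset.sum_comm, Finset.sum_eq_single (Fintype.card K - 1)]
  · rw [← Finset.mul_sum]
    have h2 : ∑ x : K, x ^ (Fintype.card K - 1) = -1 := by
      classical
      have h3 : ∀ x : K, x ^ (Fintype.card K - 1) = 1 - if x = 0 then 1 else 0 := by
        intro x
        split_ifs with hx
        · rw [hx, zero_pow (by omega), sub_self]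
        · rw [FiniteField.pow_card_sub_one_eq_one x hx, sub_zero]
      simp_rw [h3]
      rw [Finset.sum_sub_distrib]
      simp
    rw [h2, mul_neg_one]
  · intro k hk hk'
    rw [← Finset.mul_sum, FiniteField.sum_pow_lt_card_sub_one, mul_zero]
    rw [Finset.mem_range] at hk
    omega
  · intro h2
    exact absurd (Finset.mem_range.2 (by omega)) h2

/-- The Reed-Solomon code of dimension `q` on the projective line over `F_{q²}` is Hermitian
self-orthogonal. -/
theorem sum_projEval_mul_pow_eq_zero {p t q : ℕ} [Fact p.Prime] [CharP K p] (hq : q = p ^ t)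
    (hK : Fintype.card K = q ^ 2) {f g : K[X]} (hf : f.natDegree ≤ q - 1)
    (hg : g.natDegree ≤ q - 1) :
    ∑ P, projEval (q - 1) f P * projEval (q - 1) g P ^ q = 0 := by
  have hq0 : 0 < q := by rw [hq]; exact pow_pos (Fact.out : p.Prime).pos _
  -- A polynomial of degree at most `(q - 1) q` with values `g(x)^q`. The affine part of the sum is
  -- minus the coefficient of `f * g'` at `q² - 1`, that is, minus the product of the top
  -- coefficients, which is cancelled by the term at infinity.
  set g' := expand K q (g.map (iterateFrobenius K p t)) with hg'
  have hgd : g'.natDegree ≤ (q - 1) * q := by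
    rw [hg', natDegree_expand]
    exact Nat.mul_le_mul_right _ (natDegree_map_le.trans hg)
  have hcard : q - 1 + (q - 1) * q = Fintype.card K - 1 := by
    rw [hK]
    obtain ⟨r, rfl⟩ : ∃ r, q = r + 1 := ⟨q - 1, by omega⟩
    simp only [Nat.add_sub_cancel]
    have : (r + 1) ^ 2 = r + r * (r + 1) + 1 := by ring
    omega
  have he : ∀ x, (f * g').eval x = f.eval x * g.eval x ^ q := by
    intro x
    rw [eval_mul, hg', expand_eval, eval_map]
    congr 1
    have : x ^ q = iterateFrobenius K p t x := by rw [iterateFrobenius_def, hq]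
    rw [this, eval₂_at_apply, iterateFrobenius_def, hq]
  rw [Fintype.sum_option]
  simp only [projEval_none, projEval_some]
  simp_rw [← he]
  rw [sum_eval_eq_neg_coeff _ (natDegree_mul_le.trans (by omega)), ← hcard,
    coeff_mul_add_eq_of_natDegree_le hf hgd, hg', mul_comm (q - 1) q, coeff_expand_mul' hq0, coeff_map,
    iterateFrobenius_def, hq]
  ring

/-- In characteristic 2 the map `y ↦ y² + y` identifies 0 and 1, so on a finite field it misses some
`c`; then `X² + X + c` has no root. -/
theorem exists_quadratic_without_roots [CharP K 2] :
    ∃ p : K[X], p.Monic ∧ p.natDegree = 2 ∧ ∀ x, p.eval x ≠ 0 := by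
  have hns : ¬ Function.Surjective fun y : K => y ^ 2 + y := by
    rw [← Finite.injective_iff_surjective]
    intro h
    have : (0 : K) = 1 := h (by simp [CharTwo.add_self_eq_zero])
    exact zero_ne_one this
  simp only [Function.Surjective] at hns
  push Not at hns
  obtain ⟨c, hc⟩ := hns
  have e : (X ^ 2 + X + C c : K[X]) = C 1 * X ^ 2 + C 1 * X + C c := by simp
  refine ⟨X ^ 2 + X + C c, ?_, ?_, ?_⟩
  · rw [e]; exact leadingCoeff_quadratic one_ne_zero
  · rw [e]; exact natDegree_quadratic one_ne_zero
  · intro x hx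
    simp only [eval_add, eval_pow, eval_X, eval_C] at hx
    exact hc x (CharTwo.add_eq_zero.1 hx)

open Matrix in
-- All words are values of `p^e f` with `deg f ≤ 2i + 1`, where `2e = q - 2i - 2`. The multiples of
-- `p` among these `f` give `A`, and two residues modulo `p` give `B`.
theorem exists_selfOrthogonalRows [CharP K 2] {t q i : ℕ} (hq : q = 2 ^ t)
    (hK : Fintype.card K = q ^ 2) (hi : 1 ≤ i) (hiq : 2 * i + 4 ≤ q) (hq2 : 2 ∣ q) :
    ∃ (W : Submodule K (Option K → K)) (A : Matrix (Fin (2 * i)) (Option K) K)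
      (B : Matrix (Fin 2) (Option K) K), SelfOrthogonalRows q i W A B := by
  have : Fact (Nat.Prime 2) := ⟨Nat.prime_two⟩
  obtain ⟨p, hpm, hpd, hpr⟩ := exists_quadratic_without_roots (K := K)
  obtain ⟨e, he⟩ : ∃ e, q = 2 * e + (2 * i + 2) := by
    obtain ⟨s, rfl⟩ := hq2
    exact ⟨s - i - 1, by omega⟩
  have hpe : ∀ e : ℕ, (p ^ e).natDegree = 2 * e := fun e => by rw [natDegree_pow, hpd, mul_comm]
  have hper : ∀ (e : ℕ) x, (p ^ e).eval x ≠ 0 := fun e x => by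
    rw [eval_pow]; exact pow_ne_zero _ (hpr x)
  have hp0 : p ≠ 0 := hpm.ne_zero
  set ev : K[X] →ₗ[K] (Option K → K) := projEval (q - 1) with hev
  -- Modulo `p` these are 1 and `X`. The first vanishes at no finite point; the term `p * X ^ (2 * i
  -- - 1)` raises the second to degree `2i + 1`, so that it is nonzero at infinity. Thus `B` has no
  -- zero column.
  set b : Fin 2 → K[X] := ![1, X + p * X ^ (2 * i - 1)] with hb
  have hd1 : (p * X ^ (2 * i - 1)).natDegree = 2 * i + 1 := by
    rw [hpm.natDegree_mul (monic_X_pow _), hpd, natDegree_X_pow]; omega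
  have hbd : ∀ r, (b r).natDegree ≤ 2 * i + 1 := by
    intro r
    fin_cases r
    · simp [hb]
    · refine (natDegree_add_le _ _).trans ?_
      rw [hd1, natDegree_X]
      simp
  have hgen : ∀ f : K[X], f.natDegree ≤ 2 * i + 1 → (p ^ e * f).natDegree ≤ q - 1 := by
    intro f hf
    have := natDegree_mul_le (p := p ^ e) (q := f)
    rw [hpe] at this
    omega
  have hsum : ∀ f : K[X], f.natDegree < 2 * i → f = ∑ r : Fin (2 * i), f.coeff r • X ^ (r : ℕ) := by
    intro f hf
    rw [Fin.sum_univ_eq_sum_range (fun r => f.coeff r • (X : K[X]) ^ r)]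
    conv_lhs => rw [as_sum_range' f (2 * i) hf]
    simp [smul_X_eq_monomial]
  have hA : ∀ u : Option K → K, (∀ r : Fin (2 * i), ev (p ^ (e + 1) * X ^ (r : ℕ)) ⬝ᵥ u = 0) →
      ∀ f : K[X], f.natDegree < 2 * i → ev (p ^ (e + 1) * f) ⬝ᵥ u = 0 := by
    intro u hu f hf
    rw [hsum f hf, Finset.mul_sum, map_sum, sum_dotProduct]
    refine Finset.sum_eq_zero fun r _ => ?_
    rw [mul_smul_comm, map_smul, smul_dotProduct, hu r, smul_zero]
  refine ⟨(degreeLE K ((2 * i + 1 : ℕ) : WithBot ℕ)).map (ev ∘ₗ LinearMap.mulLeft K (p ^ e)),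
    fun r => ev (p ^ (e + 1) * X ^ (r : ℕ)), fun r => ev (p ^ e * b r), ?_, ?_, ?_, ?_, ?_, ?_, ?_, ?_⟩
  · intro r
    refine ⟨p * X ^ (r : ℕ), ?_, ?_⟩
    · rw [SetLike.mem_coe, mem_degreeLE, ← natDegree_le_iff_degree_le,
        hpm.natDegree_mul (monic_X_pow _), hpd, natDegree_X_pow]
      omega
    · simp [pow_succ, mul_assoc]
  · intro r
    refine ⟨b r, ?_, by simp⟩
    rw [SetLike.mem_coe, mem_degreeLE, ← natDegree_le_iff_degree_le]
    exact hbd r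
  · rw [Fintype.linearIndependent_iff]
    intro g hg
    rw [Fintype.sum_sum_type] at hg
    simp only [Sum.elim_inl, Sum.elim_inr] at hg
    set f : K[X] := ∑ r : Fin (2 * i), g (Sum.inl r) • X ^ (r : ℕ) with hf
    have hfc : ∀ r : Fin (2 * i), f.coeff r = g (Sum.inl r) := by
      intro r
      rw [hf, finsetSum_coeff]
      simp only [coeff_smul, coeff_X_pow, smul_eq_mul, mul_ite, mul_one, mul_zero, Fin.val_inj]
      rw [Finset.sum_ite_eq]
      simp
    have hfd : f.natDegree < 2 * i := by
      refine lt_of_le_of_lt (natDegree_sum_le_of_forall_le (n := 2 * i - 1) _ _ fun r _ => ?_)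
        (by omega)
      refine (natDegree_smul_le _ _).trans ?_
      rw [natDegree_X_pow]; omega
    set c := g (Sum.inr 0) with hc
    set d := g (Sum.inr 1) with hd
    set F : K[X] := p * f + (c • b 0 + d • b 1) with hF
    have hFe : ev (p ^ e * F) = 0 := by
      rw [← hg, Fin.sum_univ_two, hF, mul_add, mul_add, map_add, map_add, mul_smul_comm,
        mul_smul_comm, map_smul, map_smul, ← mul_assoc, ← pow_succ, hf, Finset.mul_sum, map_sum]
      simp_rw [mul_smul_comm, map_smul]
      rfl
    have hFd : F.natDegree ≤ 2 * i + 1 := by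
      refine (natDegree_add_le _ _).trans (max_le ?_ ((natDegree_add_le _ _).trans (max_le ?_ ?_)))
      · refine natDegree_mul_le.trans ?_
        omega
      · exact (natDegree_smul_le _ _).trans (hbd 0)
      · exact (natDegree_smul_le _ _).trans (hbd 1)
    have hF0 : F = 0 := by
      by_contra hne
      have h1 := le_ncard_support_projEval (mul_ne_zero (pow_ne_zero e hp0) hne) (hgen F hFd)
      rw [← hev, hFe, hK] at h1
      simp only [Function.support_zero, Set.ncard_empty] at h1
      have : q ≤ q ^ 2 := Nat.le_self_pow two_ne_zero q
      omega
    -- A multiple of `p` plus a remainder of degree at most 1: both must vanish.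
    have hsplit : p * (f + d • X ^ (2 * i - 1)) + (C d * X + C c) = 0 := by
      rw [← hF0, hF, hb]
      simp only [Matrix.cons_val_zero, Matrix.cons_val_one, smul_eq_C_mul]
      ring
    have hz : f + d • X ^ (2 * i - 1) = 0 := by
      by_contra hne
      have h1 : (p * (f + d • X ^ (2 * i - 1))).natDegree = 2 + (f + d • X ^ (2 * i - 1)).natDegree := by
        rw [natDegree_mul hp0 hne, hpd]
      rw [eq_neg_of_add_eq_zero_left hsplit, natDegree_neg] at h1
      have := natDegree_linear_le (a := d) (b := c)
      omega
    rw [hz, mul_zero, zero_add] at hsplit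
    have hd0 : d = 0 := by simpa using congrArg (fun s => coeff s 1) hsplit
    have hc0 : c = 0 := by simpa using congrArg (fun s => coeff s 0) hsplit
    rw [hd0, zero_smul, add_zero] at hz
    rintro (r | r)
    · rw [← hfc, hz, coeff_zero]
    · fin_cases r
      exacts [hc0, hd0]
  · rintro _ ⟨f, hf, rfl⟩ _ ⟨g, hg, rfl⟩
    rw [SetLike.mem_coe, mem_degreeLE, ← natDegree_le_iff_degree_le] at hf hg
    exact sum_projEval_mul_pow_eq_zero hq hK (hgen f hf) (hgen g hg)
  · rintro _ ⟨f, hf, rfl⟩ hw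
    rw [SetLike.mem_coe, mem_degreeLE, ← natDegree_le_iff_degree_le] at hf
    have hne : p ^ e * f ≠ 0 := by
      intro h
      apply hw
      simp only [LinearMap.comp_apply, LinearMap.mulLeft_apply, h, map_zero]
    have h1 := le_ncard_support_projEval hne (hgen f hf)
    rw [hK] at h1
    change _ ≤ (Function.support (projEval (q - 1) (p ^ e * f))).ncard + q
    omega
  · intro u hu h
    refine lt_ncard_support_of_orthogonal (D := q - 1) (hper (e + 1)) (by rw [hpe]; omega) u hu ?_
    intro f hf
    exact hA u h f hf
  · intro u hu h h'
    refine lt_ncard_support_of_orthogonal (D := q - 1) (hper e) (by rw [hpe]; omega) u hu ?_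
    intro f hf
    have hr : (f %ₘ p).natDegree < 2 := by
      rw [← hpd]
      exact natDegree_modByMonic_lt f hpm (by rintro rfl; simp at hpd)
    have hr' : f %ₘ p = C ((f %ₘ p).coeff 1) * X + C ((f %ₘ p).coeff 0) :=
      eq_X_add_C_of_natDegree_le_one (by omega)
    set c := (f %ₘ p).coeff 0
    set d := (f %ₘ p).coeff 1
    -- Division by `p` expresses any `f` of degree at most `2i + 1` through the rows of `A` and `B`;
    -- the correction removes the extra term in `b 1`.
    set g := f /ₘ p - d • X ^ (2 * i - 1) with hg
    have hgd : g.natDegree < 2 * i := by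
      refine lt_of_le_of_lt (natDegree_sub_le _ _) (max_lt ?_ ?_)
      · rw [natDegree_divByMonic _ hpm]; omega
      · refine lt_of_le_of_lt (natDegree_smul_le _ _) ?_
        rw [natDegree_X_pow]; omega
    have hfe : f = p * g + (c • b 0 + d • b 1) := by
      conv_lhs => rw [← modByMonic_add_div f p, hr']
      rw [hg, hb]
      simp only [Matrix.cons_val_zero, Matrix.cons_val_one, smul_eq_C_mul]
      ring
    have h1 : ev (p ^ e * f) ⬝ᵥ u = 0 := by
      rw [hfe, mul_add, mul_add, map_add, map_add, mul_smul_comm,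
        mul_smul_comm, map_smul, map_smul, ← mul_assoc, ← pow_succ, add_dotProduct, add_dotProduct,
        smul_dotProduct, smul_dotProduct, hA u h g hgd, h' 0, h' 1]
      simp
    exact h1
  · rintro (_ | x)
    · refine ⟨1, ?_⟩
      have e1 : q - 1 = (p ^ e).natDegree + (2 * i + 1) := by rw [hpe]; omega
      have e2 : (X + p * X ^ (2 * i - 1)).coeff (2 * i + 1) = 1 := by
        rw [coeff_add, coeff_X, if_neg (by omega), zero_add]
        have := (hpm.mul (monic_X_pow (2 * i - 1))).coeff_natDegree
        rwa [hd1] at this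
      change (p ^ e * b 1).coeff (q - 1) ≠ 0
      rw [e1, coeff_mul_add_eq_of_natDegree_le le_rfl (hbd 1)]
      simp only [hb, Matrix.cons_val_one, Matrix.cons_val_zero]
      rw [e2, (hpm.pow e).coeff_natDegree]
      simp
    · refine ⟨0, ?_⟩
      change (p ^ e * b 0).eval x ≠ 0
      simpa [hb] using hper e x

end ProjectiveLine
-- The code generated by `A + D B` and its degree
section ReducedBasic

open Matrix

variable {K : Type*} [Field K] {κ n : ℕ}

/-- A matrix over a field with linearly independent rows has a right inverse. -/
theorem exists_mul_eq_one_of_linearIndependent {m l : Type*} [Fintype m] [Fintype l]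
    [DecidableEq m] [DecidableEq l] (M : Matrix m l K) (h : LinearIndependent K M.row) :
    ∃ R : Matrix l m K, M * R = 1 := by
  obtain ⟨g, hg⟩ := LinearMap.exists_leftInverse_of_injective M.vecMulLinear
    (LinearMap.ker_eq_bot.2 (Matrix.vecMul_injective_iff.2 h))
  refine ⟨(LinearMap.toMatrix' g)ᵀ, ?_⟩
  ext a b
  have h1 : g (Pi.single a 1 ᵥ* M) = Pi.single a 1 := DFunLike.congr_fun hg _
  rw [← LinearMap.toMatrix'_mulVec g, ← Matrix.vecMul_transpose, Matrix.vecMul_vecMul] at h1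
  have h2 := congrFun h1 b
  rw [Matrix.single_one_vecMul] at h2
  rw [Matrix.one_apply]
  simpa [Pi.single_apply, eq_comm] using h2

/-- The polynomial matrix `A + D B`. -/
def pencil {m l : Type*} (A B : Matrix m l K) : Matrix m l K[X] :=
  A.map C + (X : K[X]) • B.map C

theorem pencil_apply {m l : Type*} (A B : Matrix m l K) (r : m) (c : l) :
    pencil A B r c = C (A r c) + X * C (B r c) := rfl

theorem coeff_pencil {m l : Type*} (A B : Matrix m l K) (r : m) (c : l) (k : ℕ) :
    (pencil A B r c).coeff k = if k = 0 then A r c else if k = 1 then B r c else 0 := by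
  rw [pencil_apply]
  rcases k with _ | _ | k
  · simp
  · simp
  · simp

theorem pencil_mul_map {m l s : Type*} [Fintype l] (A B : Matrix m l K) (R : Matrix l s K) :
    pencil A B * R.map C = pencil (A * R) (B * R) := by
  rw [pencil, pencil, Matrix.add_mul, Matrix.smul_mul, Matrix.map_mul, Matrix.map_mul]

/-- The rows `B 0, B 1`, followed by zero rows. -/
def padRows (κ : ℕ) {l : Type*} (B : Matrix (Fin 2) l K) : Matrix (Fin κ) l K :=
  fun r c => if h : (r : ℕ) < 2 then B ⟨r, h⟩ c else 0

theorem padRows_mul {l s : Type*} [Fintype l] (B : Matrix (Fin 2) l K) (R : Matrix l s K) :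
    padRows κ B * R = padRows κ (B * R) := by
  ext r c
  simp only [padRows, Matrix.mul_apply]
  split_ifs with h
  · rfl
  · simp

theorem exists_right_inverses {A : Matrix (Fin κ) (Fin n) K} {B : Matrix (Fin 2) (Fin n) K}
    (h : LinearIndependent K (Sum.elim A B)) :
    ∃ (R : Matrix (Fin n) (Fin κ) K) (R' : Matrix (Fin n) (Fin 2) K),
      A * R = 1 ∧ B * R = 0 ∧ A * R' = 0 ∧ B * R' = 1 := by
  obtain ⟨R, hR⟩ := exists_mul_eq_one_of_linearIndependent (Matrix.fromRows A B) (by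
    convert h using 1; ext (a | a) b <;> rfl)
  have h1 := fun a b => congrFun (congrFun hR a) b
  refine ⟨R.submatrix id Sum.inl, R.submatrix id Sum.inr, ?_, ?_, ?_, ?_⟩ <;> ext a b
  · simpa [Matrix.mul_apply, Matrix.one_apply] using h1 (Sum.inl a) (Sum.inl b)
  · simpa [Matrix.mul_apply, Matrix.one_apply] using h1 (Sum.inr a) (Sum.inl b)
  · simpa [Matrix.mul_apply, Matrix.one_apply] using h1 (Sum.inl a) (Sum.inr b)
  · simpa [Matrix.mul_apply, Matrix.one_apply] using h1 (Sum.inr a) (Sum.inr b)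

theorem pencil_one_zero {m : Type*} [DecidableEq m] : pencil (1 : Matrix m m K) 0 = 1 := by
  ext a b
  rw [pencil_apply, Matrix.one_apply, Matrix.one_apply]
  split_ifs <;> simp

theorem padRows_zero {l : Type*} : padRows κ (0 : Matrix (Fin 2) l K) = 0 := by
  ext; simp [padRows]

/-- Independence of all rows gives a constant right inverse of `A` that kills `B`; it is a right
inverse of the pencil. -/
theorem isBasic_pencil {A : Matrix (Fin κ) (Fin n) K} {B : Matrix (Fin 2) (Fin n) K}
    (h : LinearIndependent K (Sum.elim A B)) : IsBasic (pencil A (padRows κ B)) := by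
  obtain ⟨R, R', h1, h2, -, -⟩ := exists_right_inverses h
  exact ⟨R.map C, by rw [pencil_mul_map, padRows_mul, h1, h2, padRows_zero, pencil_one_zero]⟩

theorem constraintLength_pencil_padRows {A : Matrix (Fin κ) (Fin n) K}
    {B : Matrix (Fin 2) (Fin n) K} (hB : ∀ r, B r ≠ 0) (r : Fin κ) :
    constraintLength (pencil A (padRows κ B)) r = if (r : ℕ) < 2 then 1 else 0 := by
  apply le_antisymm
  · refine Finset.sup_le fun c _ => natDegree_le_iff_coeff_eq_zero.2 fun k hk => ?_
    rw [coeff_pencil]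
    split_ifs at hk <;> split_ifs <;> first | omega | rfl | simp_all [padRows]
  · split_ifs with hr
    · obtain ⟨c, hc⟩ := Function.ne_iff.1 (hB ⟨r, hr⟩)
      refine le_trans ?_ (Finset.le_sup (Finset.mem_univ c))
      refine le_natDegree_of_ne_zero ?_
      rw [coeff_pencil, if_neg one_ne_zero, if_pos rfl, padRows, dif_pos hr]
      exact hc
    · exact Nat.zero_le _

theorem overallConstraintLength_pencil_padRows {A : Matrix (Fin κ) (Fin n) K}
    {B : Matrix (Fin 2) (Fin n) K} (hκ : 2 ≤ κ) (hB : ∀ r, B r ≠ 0) :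
    overallConstraintLength (pencil A (padRows κ B)) = 2 := by
  simp_rw [overallConstraintLength, constraintLength_pencil_padRows hB]
  obtain ⟨κ, rfl⟩ := Nat.exists_eq_add_of_le' hκ
  rw [Fin.sum_univ_succ, Fin.sum_univ_succ]
  simp

theorem memory_pencil_padRows {A : Matrix (Fin κ) (Fin n) K}
    {B : Matrix (Fin 2) (Fin n) K} (hκ : 2 ≤ κ) (hB : ∀ r, B r ≠ 0) :
    memory (pencil A (padRows κ B)) = 1 := by
  simp_rw [memory, constraintLength_pencil_padRows hB]
  apply le_antisymm
  · exact Finset.sup_le fun r _ => by split_ifs <;> simp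
  · refine le_trans ?_ (Finset.le_sup (Finset.mem_univ (⟨0, by omega⟩ : Fin κ)))
    simp

/-- With total degree below 2, all rows of `G' = T G` but at most one are constant. Constant right
inverses recover `T` from `G'` and show that the constant rows have constant coefficients and do not
involve the two rows of `G` containing `D`. So `κ - 1` rows of `T` lie in a space of dimension `κ -
2`, and the rows of `G'` would be dependent. -/
theorem two_le_overallConstraintLength {A : Matrix (Fin κ) (Fin n) K}
    {B : Matrix (Fin 2) (Fin n) K} (hκ : 2 ≤ κ) (h : LinearIndependent K (Sum.elim A B))
    (G' : Matrix (Fin κ) (Fin n) K[X]) (hG' : IsBasic G')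
    (hrow : rowCode G' = rowCode (pencil A (padRows κ B))) : 2 ≤ overallConstraintLength G' := by
  by_contra! hlt
  obtain ⟨R, R', h1, h2, h3, h4⟩ := exists_right_inverses h
  set G := pencil A (padRows κ B) with hG
  have hGR : G * R.map C = 1 := by
    rw [hG, pencil_mul_map, padRows_mul, h1, h2, padRows_zero, pencil_one_zero]
  have hGR' : G * R'.map C = (X : K[X]) • (padRows κ (1 : Matrix (Fin 2) (Fin 2) K)).map C := by
    rw [hG, pencil_mul_map, padRows_mul, h3, h4]
    ext a b : 2
    simp [pencil_apply]
  have hT : ∀ r, ∃ u : Fin κ → K[X], u ᵥ* G = G' r := by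
    intro r
    have : G' r ∈ rowCode G := by
      rw [← hrow]
      exact ⟨Pi.single r 1, by simp; rfl⟩
    exact this
  choose T hT using hT
  have hTG : (Matrix.of T) * G = G' := by
    ext r c
    rw [← hT r]; rfl
  have hTR : Matrix.of T = G' * R.map C := by rw [← hTG, Matrix.mul_assoc, hGR, Matrix.mul_one]
  have hTR' : (X : K[X]) • (Matrix.of T * (padRows κ (1 : Matrix (Fin 2) (Fin 2) K)).map C) =
      G' * R'.map C := by
    rw [← hTG, Matrix.mul_assoc, hGR', Matrix.mul_smul]
  obtain ⟨r0, hr0⟩ : ∃ r0, ∀ r, r ≠ r0 → constraintLength G' r = 0 := by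
    by_cases hz : ∃ r, constraintLength G' r ≠ 0
    · obtain ⟨r0, h0⟩ := hz
      refine ⟨r0, fun r hr => ?_⟩
      by_contra hne
      have := Finset.sum_le_sum_of_subset (f := constraintLength G')
        (Finset.subset_univ ({r, r0} : Finset (Fin κ)))
      rw [Finset.sum_pair hr] at this
      rw [overallConstraintLength] at hlt
      omega
    · push Not at hz
      exact ⟨⟨0, by omega⟩, fun r _ => hz r⟩
  have hconst : ∀ r, r ≠ r0 → ∀ c, G' r c = C ((G' r c).coeff 0) := by
    intro r hr c
    refine eq_C_of_natDegree_eq_zero (Nat.le_zero.1 ?_)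
    rw [← hr0 r hr]
    exact Finset.le_sup (f := fun j => (G' r j).natDegree) (Finset.mem_univ c)
  have hconst' : ∀ {s : Type _} (N : Matrix (Fin n) s K) (r), r ≠ r0 → ∀ c,
      ∃ z, (G' * N.map C) r c = C z := by
    intro s N r hr c
    refine ⟨∑ j, (G' r j).coeff 0 * N j c, ?_⟩
    rw [Matrix.mul_apply, map_sum]
    refine Finset.sum_congr rfl fun j _ => ?_
    rw [hconst r hr j, Matrix.map_apply]
    simp
  have hTc : ∀ r, r ≠ r0 → ∀ s, T r s = C ((T r s).coeff 0) := by
    intro r hr s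
    obtain ⟨z, hz⟩ := hconst' R r hr s
    rw [← hTR, Matrix.of_apply] at hz
    rw [hz, coeff_C_zero]
  -- Multiplying by `R'` gives `X * T r s`, which is constant for these rows.
  have hT0 : ∀ r, r ≠ r0 → ∀ s : Fin κ, (s : ℕ) < 2 → T r s = 0 := by
    intro r hr s hs
    obtain ⟨z, hz⟩ := hconst' R' r hr ⟨s, hs⟩
    rw [← hTR', Matrix.smul_apply, Matrix.mul_apply, Finset.sum_eq_single s] at hz
    · have h5 := congrArg (fun f => coeff f 1) hz
      simp only [padRows, Matrix.map_apply, dif_pos hs, Matrix.one_apply_eq, map_one, mul_one,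
        smul_eq_mul, coeff_X_mul, Matrix.of_apply, coeff_C, one_ne_zero, if_false] at h5
      rw [hTc r hr s, h5, C_0]
    · intro b _ hb
      have : (padRows κ (1 : Matrix (Fin 2) (Fin 2) K)) b ⟨s, hs⟩ = 0 := by
        rw [padRows]
        split_ifs with hb'
        · exact Matrix.one_apply_ne fun e => hb (Fin.ext (Fin.mk.inj e))
        · rfl
      rw [Matrix.map_apply, this, C_0, mul_zero]
    · intro hs
      exact absurd (Finset.mem_univ s) hs
  -- The condition at `none` drops row `r0`; the others are the remaining `κ - 2` columns of `T`.
  -- These are `κ - 1` equations in `κ` unknowns.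
  let N : Option (Fin (κ - 2)) → Fin κ → K := fun o r =>
    o.elim (if r = r0 then 1 else 0) fun s => (T r ⟨s + 2, by omega⟩).coeff 0
  obtain ⟨a, ha0, -, ha⟩ := exists_orthogonal_of_card_lt N (by
    rw [Fintype.card_option, Fintype.card_fin, Fintype.card_fin]; omega)
  have har0 : a r0 = 0 := by simpa [N] using ha none
  have hzero : (fun r => C (a r)) ᵥ* Matrix.of T = 0 := by
    ext1 s
    rw [Matrix.vecMul, dotProduct, Pi.zero_apply]
    by_cases hs : (s : ℕ) < 2
    · refine Finset.sum_eq_zero fun r _ => ?_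
      by_cases hr : r = r0
      · rw [hr, har0, C_0, zero_mul]
      · rw [Matrix.of_apply, hT0 r hr s hs, mul_zero]
    · have h6 := ha (some ⟨s - 2, by omega⟩)
      rw [← C_0, ← h6, map_sum]
      refine Finset.sum_congr rfl fun r _ => ?_
      have e : (⟨(s : ℕ) - 2 + 2, by omega⟩ : Fin κ) = s := Fin.ext (by simp; omega)
      simp only [N, Option.elim_some, e]
      by_cases hr : r = r0
      · rw [hr, har0]; simp
      · rw [C_mul, ← hTc r hr s, mul_comm]; rfl
  obtain ⟨R0, hR0⟩ := hG'
  have h7 : (fun r => C (a r)) = 0 := by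
    rw [← Matrix.vecMul_one (fun r => C (a r)), ← hR0, ← hTG, Matrix.mul_assoc,
      ← Matrix.vecMul_vecMul, hzero, Matrix.zero_vecMul]
  exact ha0 (funext fun r => C_eq_zero.1 (congrFun h7 r))

theorem isConvCode_rowCode_pencil {A : Matrix (Fin κ) (Fin n) K}
    {B : Matrix (Fin 2) (Fin n) K} (hκ : 2 ≤ κ) (h : LinearIndependent K (Sum.elim A B)) :
    IsConvCode (rowCode (pencil A (padRows κ B))) κ 2 1 := by
  have hB : ∀ r, B r ≠ 0 := fun r => h.ne_zero (Sum.inr r)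
  have ho := overallConstraintLength_pencil_padRows (A := A) hκ hB
  refine ⟨_, ⟨isBasic_pencil h, fun G' hG' hr => ?_⟩, rfl, ho, memory_pencil_padRows hκ hB⟩
  rw [ho]
  exact two_le_overallConstraintLength hκ h G' hG' hr

end ReducedBasic
-- Normal bases of `K` over `F` and the Hermitian form
section QuadraticExtension

variable {F K : Type*} [Field F] [Fintype F] [Field K] [Algebra F K]

/-- The element `β a + β^q b` of `K` with coordinates `(a, b)`. -/
def toExt (β : K) (a b : F) : K :=
  β * algebraMap F K a + β ^ Fintype.card F * algebraMap F K b

theorem toExt_zero (β : K) : toExt β (0 : F) 0 = 0 := by simp [toExt]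

theorem toExt_add (β : K) (a b a' b' : F) :
    toExt β (a + a') (b + b') = toExt β a b + toExt β a' b' := by
  simp only [toExt, map_add]; ring

theorem toExt_neg (β : K) (a b : F) : toExt β (-a) (-b) = -toExt β a b := by
  simp only [toExt, map_neg]; ring

theorem toExt_mul (β : K) (c a b : F) :
    toExt β (c * a) (c * b) = algebraMap F K c * toExt β a b := by
  simp only [toExt, map_mul]; ring

theorem toExt_eq_zero_iff {β : K} (hβ : LinearIndependent F ![β, β ^ Fintype.card F]) {a b : F} :
    toExt β a b = 0 ↔ a = 0 ∧ b = 0 := by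
  refine ⟨fun h => ?_, fun ⟨h1, h2⟩ => by rw [h1, h2, toExt_zero]⟩
  refine LinearIndependent.pair_iff.1 hβ a b ?_
  rw [← h, toExt, Algebra.smul_def, Algebra.smul_def]
  ring

theorem exists_toExt_eq {β : K} (hβ : LinearIndependent F ![β, β ^ Fintype.card F])
    (hK : Module.finrank F K = 2) (z : K) : ∃ a b : F, toExt β a b = z := by
  have : Module.Finite F K := Module.finite_of_finrank_pos (by omega)
  have h := hβ.span_eq_top_of_card_eq_finrank' (by simp [hK])
  have hz : z ∈ Submodule.span F (Set.range ![β, β ^ Fintype.card F]) := h ▸ Submodule.mem_top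
  rw [Matrix.range_cons_cons_empty, Submodule.mem_span_pair] at hz
  obtain ⟨a, b, rfl⟩ := hz
  refine ⟨a, b, ?_⟩
  rw [toExt, Algebra.smul_def, Algebra.smul_def]
  ring

theorem card_eq_sq [Fintype K] (hK : Module.finrank F K = 2) :
    Fintype.card K = Fintype.card F ^ 2 := by
  rw [Module.card_eq_pow_finrank (K := F), hK]

theorem pow_card_pow_card (hK : Module.finrank F K = 2) (z : K) :
    (z ^ Fintype.card F) ^ Fintype.card F = z := by
  have : Module.Finite F K := Module.finite_of_finrank_pos (by omega)
  have : Finite K := Module.finite_of_finite F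
  let _ := Fintype.ofFinite K
  rw [← pow_mul, ← sq, ← card_eq_sq hK, FiniteField.pow_card]

theorem add_pow_card (x y : K) :
    (x + y) ^ Fintype.card F = x ^ Fintype.card F + y ^ Fintype.card F :=
  map_add (FiniteField.frobeniusAlgHom F K) x y

theorem sum_pow_card {ι : Type*} (s : Finset ι) (f : ι → K) :
    (∑ x ∈ s, f x) ^ Fintype.card F = ∑ x ∈ s, f x ^ Fintype.card F :=
  map_sum (FiniteField.frobeniusAlgHom F K) f s

theorem toExt_pow_card (hK : Module.finrank F K = 2) (β : K) (a b : F) :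
    toExt β a b ^ Fintype.card F =
      β ^ Fintype.card F * algebraMap F K a + β * algebraMap F K b := by
  rw [toExt, add_pow_card, mul_pow, mul_pow, pow_card_pow_card hK, ← map_pow, ← map_pow,
    FiniteField.pow_card, FiniteField.pow_card]

/-- The symplectic form on `F²` is the skew part of the Hermitian form on `K`. -/
theorem algebraMap_symplectic (hK : Module.finrank F K = 2) (β : K) (x z a b : F) :
    algebraMap F K (x * b - z * a) * (β ^ 2 - (β ^ Fintype.card F) ^ 2) =
      toExt β x z * toExt β a b ^ Fintype.card F - toExt β x z ^ Fintype.card F * toExt β a b := by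
  rw [toExt_pow_card hK, toExt_pow_card hK, toExt, toExt, map_sub, map_mul, map_mul]
  ring

/-- Any `β` moved by the Frobenius works: in characteristic 2 the quantity `β² - β^(2q)` is `(β -
β^q)²`, and it is also the determinant of the system formed by a linear relation and its conjugate.
-/
theorem exists_linearIndependent_pair [CharP K 2] (hK : Module.finrank F K = 2) :
    ∃ β : K, LinearIndependent F ![β, β ^ Fintype.card F] ∧
      β ^ 2 - (β ^ Fintype.card F) ^ 2 ≠ 0 := by
  have : Module.Finite F K := Module.finite_of_finrank_pos (by omega)
  have : Finite K := Module.finite_of_finite F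
  have h1 : FiniteField.frobeniusAlgHom F K ≠ 1 := by
    intro h
    have := FiniteField.orderOf_frobeniusAlgHom F K
    rw [h, orderOf_one, hK] at this
    omega
  obtain ⟨β, hβ⟩ : ∃ β : K, β ^ Fintype.card F ≠ β := by
    by_contra! h
    exact h1 (AlgHom.ext h)
  have h2 : β ^ 2 - (β ^ Fintype.card F) ^ 2 ≠ 0 := by
    rw [← sub_pow_char]
    exact pow_ne_zero _ (sub_ne_zero.2 hβ.symm)
  refine ⟨β, LinearIndependent.pair_iff.2 fun s t h => ?_, h2⟩
  have h3 : toExt β s t = 0 := by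
    rw [← h, toExt, Algebra.smul_def, Algebra.smul_def]; ring
  have h4 := toExt_pow_card hK β s t
  rw [h3, zero_pow Fintype.card_ne_zero] at h4
  rw [toExt] at h3
  constructor
  · have : algebraMap F K s * (β ^ 2 - (β ^ Fintype.card F) ^ 2) = 0 := by
      linear_combination β * h3 + β ^ Fintype.card F * h4
    simpa [h2] using this
  · have : algebraMap F K t * (β ^ 2 - (β ^ Fintype.card F) ^ 2) = 0 := by
      linear_combination (-β ^ Fintype.card F) * h3 - β * h4
    simpa [h2] using this

/-- The equations for `β` and `β^q` are linear in `T` and `T^q` with determinant `±(β² - β^(2q))`.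
This is why each row of the code over `K` is expanded twice. -/
theorem eq_zero_of_skew_eq_zero (hK : Module.finrank F K = 2) {β T : K}
    (hβ : β ^ 2 - (β ^ Fintype.card F) ^ 2 ≠ 0)
    (h : ∀ s : Fin 2, ![β, β ^ Fintype.card F] s * T -
      ![β, β ^ Fintype.card F] s ^ Fintype.card F * T ^ Fintype.card F = 0) : T = 0 := by
  have h0 := h 0
  have h1 := h 1
  simp only [Matrix.cons_val_zero, Matrix.cons_val_one, pow_card_pow_card hK] at h0 h1
  have : T * (β ^ 2 - (β ^ Fintype.card F) ^ 2) = 0 := by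
    linear_combination β * h0 - β ^ Fintype.card F * h1
  simpa [hβ] using this

end QuadraticExtension

/-! ### Stabilizer matrices from codes over `K` -/

section Expansion

open Matrix

variable {F K : Type*} [Field F] [Fintype F] [Field K] [Algebra F K] {r κ n : ℕ}

/-- The rows of `S` are the coordinate vectors of the rows of `G`, multiplied by the elements of
the basis `(β, β^q)`. -/
def IsExpansion (β : K) (e : Fin r ≃ Fin κ × Fin 2) (S : Matrix (Fin r) (Fin n ⊕ Fin n) F[X])
    (G : Matrix (Fin κ) (Fin n) K[X]) : Prop :=
  ∀ x l, combine β (S x) l = C (![β, β ^ Fintype.card F] (e x).2) * G (e x).1 l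

theorem coeff_combine (β : K) (f : Fin n ⊕ Fin n → F[X]) (l : Fin n) (k : ℕ) :
    (combine β f l).coeff k = toExt β ((f (Sum.inl l)).coeff k) ((f (Sum.inr l)).coeff k) := by
  simp [combine, toExt, -map_pow]

theorem combine_vecMul (β : K) (u : Fin r → F[X]) (S : Matrix (Fin r) (Fin n ⊕ Fin n) F[X])
    (l : Fin n) :
    combine β (u ᵥ* S) l = ∑ x, (u x).map (algebraMap F K) * combine β (S x) l := by
  simp only [combine, Matrix.vecMul, dotProduct, Polynomial.map_sum, Polynomial.map_mul,
    Finset.mul_sum, ← Finset.sum_add_distrib]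
  exact Finset.sum_congr rfl fun x _ => by ring

theorem exists_polynomial_coordinates {β : K}
    (hβ : LinearIndependent F ![β, β ^ Fintype.card F]) (hK : Module.finrank F K = 2) (g : K[X]) :
    ∃ a b : F[X], C β * a.map (algebraMap F K) +
      C (β ^ Fintype.card F) * b.map (algebraMap F K) = g := by
  induction g using Polynomial.induction_on' with
  | add p q hp hq =>
    obtain ⟨a, b, rfl⟩ := hp
    obtain ⟨a', b', rfl⟩ := hq
    exact ⟨a + a', b + b', by simp only [Polynomial.map_add]; ring⟩
  | monomial k z =>
    obtain ⟨a, b, rfl⟩ := exists_toExt_eq hβ hK z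
    refine ⟨monomial k a, monomial k b, ?_⟩
    simp only [map_monomial, C_mul_monomial, ← map_add]
    rfl

theorem exists_isExpansion {β : K} (hβ : LinearIndependent F ![β, β ^ Fintype.card F])
    (hK : Module.finrank F K = 2) (e : Fin r ≃ Fin κ × Fin 2) (G : Matrix (Fin κ) (Fin n) K[X]) :
    ∃ S : Matrix (Fin r) (Fin n ⊕ Fin n) F[X], IsExpansion β e S G := by
  choose P Q h using exists_polynomial_coordinates (F := F) hβ hK
  let g : Fin r → Fin n → K[X] := fun x l =>
    C (![β, β ^ Fintype.card F] (e x).2) * G (e x).1 l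
  exact ⟨fun x => Sum.elim (fun l => P (g x l)) fun l => Q (g x l), fun x l => h (g x l)⟩

variable {β : K} {e : Fin r ≃ Fin κ × Fin 2} {S : Matrix (Fin r) (Fin n ⊕ Fin n) F[X]}
  {G : Matrix (Fin κ) (Fin n) K[X]}

theorem IsExpansion.toExt_coeff (hS : IsExpansion β e S G) (x : Fin r) (l : Fin n) (k : ℕ) :
    toExt β ((S x (Sum.inl l)).coeff k) ((S x (Sum.inr l)).coeff k) =
      ![β, β ^ Fintype.card F] (e x).2 * (G (e x).1 l).coeff k := by
  rw [← coeff_combine, hS x l, coeff_C_mul]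

theorem IsExpansion.combine_vecMul (hS : IsExpansion β e S G) (u : Fin r → F[X]) :
    combine β (u ᵥ* S) = (fun s => C β * (u (e.symm (s, 0))).map (algebraMap F K) +
      C (β ^ Fintype.card F) * (u (e.symm (s, 1))).map (algebraMap F K)) ᵥ* G := by
  ext1 l
  rw [QConv.combine_vecMul, ← e.symm.sum_comp, Fintype.sum_prod_type, Matrix.vecMul, dotProduct]
  refine Finset.sum_congr rfl fun s _ => ?_
  rw [Fin.sum_univ_two, hS, hS]
  simp only [Equiv.apply_symm_apply, Matrix.cons_val_zero, Matrix.cons_val_one]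
  ring

/-- Since each row occurs with both basis elements as factors, polynomial combinations over `F`
already give all those over `K`. -/
theorem IsExpansion.coe_rowCode (hS : IsExpansion β e S G)
    (hβ : LinearIndependent F ![β, β ^ Fintype.card F]) (hK : Module.finrank F K = 2) :
    (rowCode G : Set (Fin n → K[X])) = {v | ∃ u : Fin r → F[X], v = combine β (u ᵥ* S)} := by
  ext v
  constructor
  · rintro ⟨w, rfl⟩
    choose P Q h using exists_polynomial_coordinates (F := F) hβ hK
    refine ⟨fun x => if (e x).2 = 0 then P (w (e x).1) else Q (w (e x).1), ?_⟩
    rw [hS.combine_vecMul]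
    simp [h, -map_pow]
  · rintro ⟨u, rfl⟩
    rw [hS.combine_vecMul]
    exact ⟨_, rfl⟩

theorem IsExpansion.linearIndependent_row (hS : IsExpansion β e S G)
    (hβ : LinearIndependent F ![β, β ^ Fintype.card F]) (hG : IsBasic G) :
    LinearIndependent F[X] S.row := by
  rw [← Matrix.vecMul_injective_iff]
  refine (injective_iff_map_eq_zero S.vecMulLinear).2 fun u hu => ?_
  change u ᵥ* S = 0 at hu
  have h1 := hS.combine_vecMul u
  rw [hu] at h1
  have h0 : combine β (0 : Fin n ⊕ Fin n → F[X]) = 0 := by ext1; simp [combine]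
  obtain ⟨R, hR⟩ := hG
  have h2 := congrArg (fun v => v ᵥ* R) h1
  simp only [h0, Matrix.zero_vecMul, Matrix.vecMul_vecMul, hR, Matrix.vecMul_one] at h2
  have h3 : ∀ s k, (u (e.symm (s, 0))).coeff k = 0 ∧ (u (e.symm (s, 1))).coeff k = 0 := by
    intro s k
    rw [← toExt_eq_zero_iff hβ]
    have := congrArg (fun f => coeff f k) (congrFun h2 s)
    simpa [toExt, -map_pow] using this.symm
  ext x k
  obtain ⟨⟨s, c⟩, rfl⟩ := e.symm.surjective x
  fin_cases c
  exacts [(h3 s k).1, (h3 s k).2]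

theorem IsExpansion.coeff_eq_zero (hS : IsExpansion β e S G)
    (hβ : LinearIndependent F ![β, β ^ Fintype.card F]) {k : ℕ}
    (hG : ∀ s l, (G s l).coeff k = 0) (x : Fin r) (y : Fin n ⊕ Fin n) :
    (S x y).coeff k = 0 := by
  have h : ∀ l, (S x (Sum.inl l)).coeff k = 0 ∧ (S x (Sum.inr l)).coeff k = 0 := fun l => by
    rw [← toExt_eq_zero_iff hβ, hS.toExt_coeff, hG, mul_zero]
  rcases y with l | l
  exacts [(h l).1, (h l).2]

theorem IsExpansion.natDegree_le (hS : IsExpansion β e S G)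
    (hβ : LinearIndependent F ![β, β ^ Fintype.card F]) {m : ℕ}
    (hG : ∀ s l, (G s l).natDegree ≤ m) (x : Fin r) (y : Fin n ⊕ Fin n) :
    (S x y).natDegree ≤ m :=
  natDegree_le_iff_coeff_eq_zero.2 fun _ hk => hS.coeff_eq_zero hβ
    (fun s l => coeff_eq_zero_of_natDegree_lt ((hG s l).trans_lt hk)) x y

theorem natDegree_le_memory {m : ℕ} {ι : Type*} [Fintype ι] (M : Matrix (Fin m) ι K[X]) (x y) :
    (M x y).natDegree ≤ memory M :=
  (Finset.le_sup (f := fun j => (M x j).natDegree) (Finset.mem_univ y)).trans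
    (Finset.le_sup (f := fun i => constraintLength M i) (Finset.mem_univ x))

theorem memory_le {m d : ℕ} {ι : Type*} [Fintype ι] {M : Matrix (Fin m) ι K[X]}
    (h : ∀ x y, (M x y).natDegree ≤ d) : memory M ≤ d :=
  Finset.sup_le fun x _ => Finset.sup_le fun y _ => h x y

theorem IsExpansion.memory_eq (hS : IsExpansion β e S G)
    (hβ : LinearIndependent F ![β, β ^ Fintype.card F]) : memory S = memory G := by
  apply le_antisymm
  · exact memory_le (hS.natDegree_le hβ (natDegree_le_memory G))
  · refine memory_le fun s l => natDegree_le_iff_coeff_eq_zero.2 fun k hk => ?_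
    have h1 := hS.toExt_coeff (e.symm (s, 0)) l k
    rw [coeff_eq_zero_of_natDegree_lt ((natDegree_le_memory S _ _).trans_lt hk),
      coeff_eq_zero_of_natDegree_lt ((natDegree_le_memory S _ _).trans_lt hk), toExt_zero,
      Equiv.apply_symm_apply] at h1
    have hb : β ≠ 0 := hβ.ne_zero 0
    simpa [hb] using h1.symm

/-- All coefficient vectors lie in the Hermitian self-orthogonal `W`, so both halves of the skew
part vanish for every pair of coefficients, not only for their sum over a shift. -/
theorem IsExpansion.symplectic_eq_zero (hS : IsExpansion β e S G) (hK : Module.finrank F K = 2)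
    (hβ : β ^ 2 - (β ^ Fintype.card F) ^ 2 ≠ 0) {W : Submodule K (Fin n → K)}
    (hW : ∀ w ∈ W, ∀ w' ∈ W, ∑ l, w l * w' l ^ Fintype.card F = 0)
    (hG : ∀ s k, (fun l => (G s l).coeff k) ∈ W) (x y : Fin r) (k k' : ℕ) :
    ∑ l, ((S x (Sum.inl l)).coeff k * (S y (Sum.inr l)).coeff k' -
      (S x (Sum.inr l)).coeff k * (S y (Sum.inl l)).coeff k') = 0 := by
  have hmem : ∀ (x : Fin r) (k : ℕ),
      (fun l => toExt β ((S x (Sum.inl l)).coeff k) ((S x (Sum.inr l)).coeff k)) ∈ W := by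
    intro x k
    simp_rw [hS.toExt_coeff]
    exact W.smul_mem _ (hG _ k)
  apply (algebraMap F K).injective
  apply mul_right_cancel₀ hβ
  rw [map_sum, Finset.sum_mul, map_zero, zero_mul]
  simp_rw [algebraMap_symplectic hK]
  rw [Finset.sum_sub_distrib, hW _ (hmem x k) _ (hmem y k'), zero_sub, neg_eq_zero]
  rw [← hW _ (hmem y k') _ (hmem x k)]
  exact Finset.sum_congr rfl fun l _ => mul_comm _ _

omit [Fintype F] in
theorem isStabilizerMatrix_of_symplectic (hd : ∀ x y, (S x y).natDegree ≤ 1)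
    (hli : LinearIndependent F[X] S.row)
    (h : ∀ (x y : Fin r) (k k' : ℕ),
      ∑ l, ((S x (Sum.inl l)).coeff k * (S y (Sum.inr l)).coeff k' -
        (S x (Sum.inr l)).coeff k * (S y (Sum.inl l)).coeff k') = 0) :
    IsStabilizerMatrix S := by
  refine ⟨hli, ?_⟩
  have hL : ∀ x y, toLaurent (S x y) = LaurentPolynomial.C ((S x y).coeff 0) +
      LaurentPolynomial.C ((S x y).coeff 1) * LaurentPolynomial.T 1 := by
    intro x y
    conv_lhs => rw [eq_X_add_C_of_natDegree_le_one (hd x y)]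
    rw [map_add, map_mul, toLaurent_C, toLaurent_C, toLaurent_X, add_comm]
  have hI : ∀ x y, LaurentPolynomial.invert (toLaurent (S x y)) =
      LaurentPolynomial.C ((S x y).coeff 0) +
      LaurentPolynomial.C ((S x y).coeff 1) * LaurentPolynomial.T (-1) := by
    intro x y
    rw [hL, map_add, map_mul, LaurentPolynomial.invert_C, LaurentPolynomial.invert_C,
      LaurentPolynomial.invert_T]
  ext1 x y
  rw [Matrix.sub_apply, Matrix.mul_apply, Matrix.mul_apply, ← Finset.sum_sub_distrib]
  simp only [Matrix.map_apply, Matrix.transpose_apply, Matrix.toCols₁_apply, Matrix.toCols₂_apply,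
    hI, Matrix.zero_apply]
  simp only [hL]
  have hT : (LaurentPolynomial.T 1 : LaurentPolynomial F) * LaurentPolynomial.T (-1) = 1 := by
    rw [← LaurentPolynomial.T_add]; simp
  have h' := fun k k' => congrArg (LaurentPolynomial.C (R := F)) (h x y k k')
  simp only [map_sum, map_sub, map_mul, map_zero] at h'
  -- The entry has coefficients only at `T^0`, `T^1` and `T^(-1)`; each is a sum of vanishing
  -- symplectic products.
  have key : (∑ l, ((LaurentPolynomial.C ((S x (Sum.inl l)).coeff 0) *
      LaurentPolynomial.C ((S y (Sum.inr l)).coeff 0)) -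
      (LaurentPolynomial.C ((S x (Sum.inr l)).coeff 0) *
      LaurentPolynomial.C ((S y (Sum.inl l)).coeff 0)))) +
    (∑ l, ((LaurentPolynomial.C ((S x (Sum.inl l)).coeff 1) *
      LaurentPolynomial.C ((S y (Sum.inr l)).coeff 1)) -
      (LaurentPolynomial.C ((S x (Sum.inr l)).coeff 1) *
      LaurentPolynomial.C ((S y (Sum.inl l)).coeff 1)))) +
    (∑ l, ((LaurentPolynomial.C ((S x (Sum.inl l)).coeff 1) *
      LaurentPolynomial.C ((S y (Sum.inr l)).coeff 0)) -
      (LaurentPolynomial.C ((S x (Sum.inr l)).coeff 1) *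
      LaurentPolynomial.C ((S y (Sum.inl l)).coeff 0)))) * LaurentPolynomial.T 1 +
    (∑ l, ((LaurentPolynomial.C ((S x (Sum.inl l)).coeff 0) *
      LaurentPolynomial.C ((S y (Sum.inr l)).coeff 1)) -
      (LaurentPolynomial.C ((S x (Sum.inr l)).coeff 0) *
      LaurentPolynomial.C ((S y (Sum.inl l)).coeff 1)))) * LaurentPolynomial.T (-1) = 0 := by
    rw [h', h', h', h']; simp
  rw [← key, Finset.sum_mul, Finset.sum_mul, ← Finset.sum_add_distrib, ← Finset.sum_add_distrib,
    ← Finset.sum_add_distrib]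
  refine Finset.sum_congr rfl fun l _ => ?_
  linear_combination (LaurentPolynomial.C ((S x (Sum.inl l)).coeff 1) *
      LaurentPolynomial.C ((S y (Sum.inr l)).coeff 1) -
      LaurentPolynomial.C ((S x (Sum.inr l)).coeff 1) *
      LaurentPolynomial.C ((S y (Sum.inl l)).coeff 1)) * hT

end Expansion
-- Free distance of the dual convolutional code
section Codes

open Matrix

variable {K : Type*} [Field K]

theorem ncard_support_comp_equiv {ι ι' : Type*} (σ : ι ≃ ι') (u : ι' → K) :
    (Function.support (u ∘ σ)).ncard = (Function.support u).ncard := by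
  rw [← Set.ncard_image_of_injective _ σ.injective, Function.support_comp_eq_preimage,
    Set.image_preimage_eq _ σ.surjective]

theorem SelfOrthogonalRows.reindex {ι ι' : Type*} [Fintype ι] [Fintype ι'] {q i : ℕ}
    {W : Submodule K (ι → K)} {A : Matrix (Fin (2 * i)) ι K} {B : Matrix (Fin 2) ι K}
    (h : SelfOrthogonalRows q i W A B) (σ : ι' ≃ ι) :
    SelfOrthogonalRows q i (W.map (LinearMap.funLeft K K σ)) (A.submatrix id σ)
      (B.submatrix id σ) where
  left_mem r := ⟨A r, h.left_mem r, rfl⟩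
  right_mem r := ⟨B r, h.right_mem r, rfl⟩
  linearIndependent := by
    have h1 := h.linearIndependent.map' (LinearMap.funLeft K K σ)
      (LinearMap.ker_eq_bot.2 (LinearMap.funLeft_injective_of_surjective K K _ σ.surjective))
    have e : LinearMap.funLeft K K σ ∘ Sum.elim A B =
        Sum.elim (A.submatrix id σ) (B.submatrix id σ) := by
      ext (r | r) P <;> rfl
    exact e ▸ h1
  selfOrthogonal := by
    rintro _ ⟨w, hw, rfl⟩ _ ⟨w', hw', rfl⟩
    rw [← h.selfOrthogonal w hw w' hw']
    exact σ.sum_comp fun P => w P * w' P ^ q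
  distance := by
    rintro _ ⟨w, hw, rfl⟩ h0
    change _ ≤ (Function.support (w ∘ σ)).ncard + q
    rw [ncard_support_comp_equiv]
    exact h.distance w hw fun e => h0 (by rw [e, map_zero])
  left_dual u hu hA := by
    rw [← ncard_support_comp_equiv σ.symm]
    refine h.left_dual _ (fun e => hu ?_) fun r => ?_
    · rw [← Function.comp_id u, ← σ.symm_comp_self, ← Function.comp_assoc, e]; rfl
    · rw [← hA r, dotProduct_comp_equiv_symm]; rfl
  dual u hu hA hB := by
    rw [← ncard_support_comp_equiv σ.symm]
    refine h.dual _ (fun e => hu ?_) (fun r => ?_) fun r => ?_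
    · rw [← Function.comp_id u, ← σ.symm_comp_self, ← Function.comp_assoc, e]; rfl
    · rw [← hA r, dotProduct_comp_equiv_symm]; rfl
    · rw [← hB r, dotProduct_comp_equiv_symm]; rfl
  right_ne_zero P := h.right_ne_zero (σ P)

/-- A vector of weight 1 orthogonal to `B` would exhibit a zero column. -/
theorem two_le_ncard_support {ι : Type*} [Fintype ι] {B : Matrix (Fin 2) ι K}
    (hB : ∀ P, ∃ r, B r P ≠ 0) {u : ι → K} (hu : u ≠ 0) (h : ∀ r, B r ⬝ᵥ u = 0) :
    2 ≤ (Function.support u).ncard := by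
  by_contra! hlt
  obtain ⟨P, hP⟩ := Function.ne_iff.1 hu
  have h1 := (Set.ncard_le_one (Set.toFinite _)).1 (Nat.lt_succ_iff.1 hlt)
  obtain ⟨r, hr⟩ := hB P
  have h2 := h r
  rw [dotProduct, Finset.sum_eq_single P] at h2
  · exact mul_ne_zero hr hP h2
  · intro b _ hb
    by_contra hne
    exact hb (h1 b (right_ne_zero_of_mul hne) P hP)
  · simp

theorem ncard_support_frame_le {n : ℕ} {u : ℤ × Fin n → K} (hu : (Function.support u).Finite)
    (j : ℤ) : (Function.support fun l => u (j, l)).ncard ≤ (Function.support u).ncard := by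
  rw [← Set.ncard_image_of_injective _ (Prod.mk_right_injective j)]
  refine Set.ncard_le_ncard ?_ hu
  rintro _ ⟨l, hl, rfl⟩
  exact hl

theorem ncard_support_frame_add_le {n : ℕ} {u : ℤ × Fin n → K}
    (hu : (Function.support u).Finite) {j j' : ℤ} (hj : j ≠ j') :
    (Function.support fun l => u (j, l)).ncard + (Function.support fun l => u (j', l)).ncard ≤
      (Function.support u).ncard := by
  rw [← Set.ncard_image_of_injective _ (Prod.mk_right_injective j),
    ← Set.ncard_image_of_injective (Function.support fun l => u (j', l))
      (Prod.mk_right_injective j'), ← Set.ncard_union_eq ?_ (Set.toFinite _) (Set.toFinite _)]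
  · refine Set.ncard_le_ncard ?_ hu
    rintro _ (⟨l, hl, rfl⟩ | ⟨l, hl, rfl⟩)
    exacts [hl, hl]
  · rw [Set.disjoint_left]
    rintro _ ⟨l, -, rfl⟩ ⟨l', -, h⟩
    exact hj (Prod.mk.inj h).1.symm

/-- The free distance of the dual of the convolutional code generated by `A + D B`. -/
theorem SelfOrthogonalRows.lt_ncard_support {n q i : ℕ} {W : Submodule K (Fin n → K)}
    {A : Matrix (Fin (2 * i)) (Fin n) K} {B : Matrix (Fin 2) (Fin n) K}
    (h : SelfOrthogonalRows q i W A B) (hi : 1 ≤ i) {u : ℤ × Fin n → K}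
    (hfin : (Function.support u).Finite) (hu : u ≠ 0)
    (horth : ∀ j r, ∑ l, (A r l * u (j, l) + padRows (2 * i) B r l * u (j + 1, l)) = 0) :
    2 * i + 2 < (Function.support u).ncard := by
  have horth' : ∀ j r, A r ⬝ᵥ (fun l => u (j, l)) +
      padRows (2 * i) B r ⬝ᵥ (fun l => u (j + 1, l)) = 0 := by
    intro j r
    rw [← horth j r, Finset.sum_add_distrib]; rfl
  have hpad : ∀ (r : Fin 2) (v : Fin n → K),
      padRows (2 * i) B ⟨r, by omega⟩ ⬝ᵥ v = B r ⬝ᵥ v := by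
    intro r v
    congr 1
    ext l
    exact dif_pos r.2
  -- The nonzero frames. The check straddling the last one involves only `A`, the check straddling
  -- the first one only `B`.
  set J : Finset ℤ := (hfin.image Prod.fst).toFinset with hJ
  have hmem : ∀ j, j ∈ J ↔ (fun l => u (j, l)) ≠ 0 := by
    intro j
    rw [Function.ne_iff]
    simp [hJ]
  have hJne : J.Nonempty := by
    obtain ⟨⟨j, l⟩, hjl⟩ := Function.ne_iff.1 hu
    exact ⟨j, (hmem j).2 (Function.ne_iff.2 ⟨l, hjl⟩)⟩
  have hout : ∀ j, j ∉ J → (fun l => u (j, l)) = 0 := fun j hj => by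
    by_contra hne
    exact hj ((hmem j).2 hne)
  have hmax : (fun l => u (J.max' hJne + 1, l)) = 0 :=
    hout _ fun hj => by have := J.le_max' _ hj; omega
  have hmin : (fun l => u (J.min' hJne - 1, l)) = 0 :=
    hout _ fun hj => by have := J.min'_le _ hj; omega
  have hA : ∀ r, A r ⬝ᵥ (fun l => u (J.max' hJne, l)) = 0 := by
    intro r
    have := horth' (J.max' hJne) r
    rwa [hmax, dotProduct_zero, add_zero] at this
  have hB : ∀ r, B r ⬝ᵥ (fun l => u (J.min' hJne, l)) = 0 := by
    intro r
    have := horth' (J.min' hJne - 1) ⟨r, by omega⟩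
    rwa [hmin, dotProduct_zero, zero_add, sub_add_cancel, hpad] at this
  have hmax0 := (hmem _).1 (J.max'_mem hJne)
  have hmin0 := (hmem _).1 (J.min'_mem hJne)
  by_cases heq : J.min' hJne = J.max' hJne
  · rw [heq] at hB
    exact (h.dual _ hmax0 hA hB).trans_le (ncard_support_frame_le hfin _)
  · have h1 := h.left_dual _ hmax0 hA
    have h2 := two_le_ncard_support h.right_ne_zero hmin0 hB
    have h3 := ncard_support_frame_add_le hfin heq
    omega

end Codes

/-! ### Coordinates of shifted rows -/

section Stream

variable {F : Type*} [Field F] {n : ℕ}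

theorem stream_apply (j : ℤ) (f : Fin n → F[X]) (k : ℤ) (l : Fin n) :
    stream j f (k, l) = if j ≤ k then (f l).coeff (k - j).toNat else 0 := by
  classical
  rw [stream, Finsupp.finsetSum_apply, Finset.sum_eq_single l]
  · rw [Finsupp.finsetSum_apply]
    split_ifs with h
    · obtain ⟨s, rfl⟩ := Int.le.dest h
      rw [Finset.sum_eq_single s]
      · simp
      · intro b _ hb
        rw [Finsupp.single_eq_of_ne]
        simpa using hb.symm
      · intro hs
        simpa using hs
    · refine Finset.sum_eq_zero fun s _ => Finsupp.single_eq_of_ne ?_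
      intro e
      have := (Prod.mk.inj e).1
      omega
  · intro b _ hb
    rw [Finsupp.finsetSum_apply]
    refine Finset.sum_eq_zero fun s _ => Finsupp.single_eq_of_ne ?_
    intro e
    exact hb (Prod.mk.inj e).2.symm
  · simp

theorem dot_stream (b : ℤ × Fin n →₀ F) (j : ℤ) (f : Fin n → F[X])
    (hf : ∀ l, (f l).natDegree ≤ 1) :
    dot b (stream j f) = ∑ l, (b (j, l) * (f l).coeff 0 + b (j + 1, l) * (f l).coeff 1) := by
  rw [stream, dot_sum_right]
  refine Finset.sum_congr rfl fun l _ => ?_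
  rw [dot_sum_right]
  simp_rw [dot_single_right]
  rw [Finset.sum_subset (s₂ := Finset.range 2), Finset.sum_range_succ, Finset.sum_range_one]
  · simp
  · intro s hs
    have := (le_natDegree_of_mem_supp s hs).trans (hf l)
    rw [Finset.mem_range]; omega
  · intro s _ hs
    rw [notMem_support_iff.1 hs, mul_zero]

end Stream

/-! ### Commutation with the stabilizer and its frames -/

section Distance

open Matrix

variable {F K : Type*} [Field F] [Fintype F] [Field K] [Algebra F K] {r κ n : ℕ}
  {β : K} {e : Fin r ≃ Fin κ × Fin 2} {S : Matrix (Fin r) (Fin n ⊕ Fin n) F[X]}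

theorem ncard_toExt {ι : Type*} (hβ : LinearIndependent F ![β, β ^ Fintype.card F])
    (a b : ι → F) :
    Set.ncard {k | a k ≠ 0 ∨ b k ≠ 0} = (Function.support fun k => toExt β (a k) (b k)).ncard := by
  congr 1
  ext k
  rw [Function.mem_support, Ne, toExt_eq_zero_iff hβ, not_and_or]
  rfl

omit [Algebra F K] in
theorem support_pow_card {ι : Type*} (v : ι → K) :
    (Function.support fun k => v k ^ Fintype.card F) = Function.support v := by
  ext k
  simp [Fintype.card_ne_zero]

theorem finite_support_toExt {ι : Type*} (a b : ι →₀ F) :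
    (Function.support fun k => toExt β (a k) (b k)).Finite := by
  refine (a.hasFiniteSupport.union b.hasFiniteSupport).subset fun k hk => ?_
  by_contra hn
  simp only [Set.mem_union, Function.mem_support, not_or, not_not] at hn
  exact hk (by simp only [hn, toExt_zero])

/-- The commutator form of `X(a) Z(b)` and the generators belonging to a row of `S`. -/
def commForm (S : Matrix (Fin r) (Fin n ⊕ Fin n) F[X]) (a b : ℤ × Fin n →₀ F) (x : Fin r)
    (j : ℤ) : F :=
  dot b (stream j (S.toCols₁ x)) - dot (stream j (S.toCols₂ x)) a

/-- The symplectic product becomes the skew part of `c * T`, where `c` is `β` or `β^q` and `T` is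
the parity check of `A + D B` at shift `j`. Conjugating the error to `u` makes `T` linear in `u`. -/
theorem commForm_eq {A B : Matrix (Fin κ) (Fin n) K} (hS : IsExpansion β e S (pencil A B))
    (hK : Module.finrank F K = 2) (hd : ∀ x y, (S x y).natDegree ≤ 1)
    (a b : ℤ × Fin n →₀ F) (x : Fin r) (j : ℤ) :
    let u := fun k => toExt β (a k) (b k) ^ Fintype.card F
    let T := ∑ l, (A (e x).1 l * u (j, l) + B (e x).1 l * u (j + 1, l))
    algebraMap F K (commForm S a b x j) * (β ^ 2 - (β ^ Fintype.card F) ^ 2) =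
      ![β, β ^ Fintype.card F] (e x).2 * T -
        ![β, β ^ Fintype.card F] (e x).2 ^ Fintype.card F * T ^ Fintype.card F := by
  intro u T
  have h0 := fun l => hS.toExt_coeff x l 0
  have h1 := fun l => hS.toExt_coeff x l 1
  simp only [coeff_pencil, if_true, one_ne_zero, if_false] at h0 h1
  have e1 : commForm S a b x j = ∑ l,
      (((S x (Sum.inl l)).coeff 0 * b (j, l) - (S x (Sum.inr l)).coeff 0 * a (j, l)) +
      ((S x (Sum.inl l)).coeff 1 * b (j + 1, l) - (S x (Sum.inr l)).coeff 1 * a (j + 1, l))) := by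
    rw [commForm, dot_comm _ a, dot_stream b j (S.toCols₁ x) fun l => hd x _,
      dot_stream a j (S.toCols₂ x) fun l => hd x _, ← Finset.sum_sub_distrib]
    refine Finset.sum_congr rfl fun l _ => ?_
    simp only [toCols₁_apply, toCols₂_apply]
    ring
  rw [e1, map_sum, Finset.sum_mul]
  simp only [T]
  rw [sum_pow_card, Finset.mul_sum, Finset.mul_sum, ← Finset.sum_sub_distrib]
  refine Finset.sum_congr rfl fun l _ => ?_
  rw [map_add, add_mul, algebraMap_symplectic hK, algebraMap_symplectic hK, h0, h1, add_pow_card,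
    mul_pow, mul_pow, mul_pow, mul_pow]
  simp only [u, pow_card_pow_card hK]
  ring

theorem isPauli_generator (S : Matrix (Fin r) (Fin n ⊕ Fin n) F[X]) (j : ℤ) (x : Fin r) (c : F) :
    IsPauli (pauliX (c • stream j (S.toCols₁ x)) * pauliZ (c • stream j (S.toCols₂ x)))
      (c • stream j (S.toCols₁ x)) (c • stream j (S.toCols₂ x)) :=
  isPauli_mul _ _

/-- An error commutes with the whole stabilizer iff all commutator forms vanish. -/
theorem forall_commute_iff {E : StateSpace F (ℤ × Fin n) ≃ₗ[ℂ] StateSpace F (ℤ × Fin n)}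
    {a b : ℤ × Fin n →₀ F} (hE : IsPauli E a b) :
    (∀ A ∈ stabilizer S, Commute E A) ↔ ∀ x j, commForm S a b x j = 0 := by
  have hc : ∀ j x c, Commute E (pauliX (c • stream j (S.toCols₁ x)) *
      pauliZ (c • stream j (S.toCols₂ x))) ↔ chi F (c * commForm S a b x j) = 1 := by
    intro j x c
    rw [hE.commute_iff (isPauli_generator S j x c), dot_smul_right, dot_smul_left, ← mul_sub]
    rfl
  constructor
  · intro h x j
    refine eq_zero_of_chi_mul_eq_one _ fun c => (hc j x c).1 (h _ ?_)
    exact Subgroup.subset_closure ⟨j, x, c, rfl⟩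
  · intro h A hA
    induction hA using Subgroup.closure_induction with
    | mem A hA =>
      obtain ⟨j, x, c, rfl⟩ := hA
      rw [hc, h, mul_zero, AddChar.map_zero_eq_one]
    | one => exact Commute.one_right E
    | mul A B _ _ hA hB => exact hA.mul_right hB
    | inv A _ hA => exact hA.inv_right

/-- Each frame of a shifted row is a coefficient vector in `W` or zero, and labels add under
multiplication. -/
theorem exists_isPauli_of_mem_stabilizer {G : Matrix (Fin κ) (Fin n) K[X]}
    (hS : IsExpansion β e S G) {W : Submodule K (Fin n → K)}
    (hG : ∀ s k, (fun l => (G s l).coeff k) ∈ W)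
    {A : StateSpace F (ℤ × Fin n) ≃ₗ[ℂ] StateSpace F (ℤ × Fin n)} (hA : A ∈ stabilizer S) :
    ∃ a b, IsPauli A a b ∧ ∀ j, (fun l => toExt β (a (j, l)) (b (j, l))) ∈ W := by
  induction hA using Subgroup.closure_induction with
  | mem A hA =>
    obtain ⟨j, x, c, rfl⟩ := hA
    refine ⟨_, _, isPauli_generator S j x c, fun k => ?_⟩
    simp only [Finsupp.smul_apply, smul_eq_mul, toExt_mul, stream_apply]
    by_cases hjk : j ≤ k
    · simp only [if_pos hjk, toCols₁_apply, toCols₂_apply, hS.toExt_coeff]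
      exact W.smul_mem _ (W.smul_mem _ (hG _ _))
    · simp only [if_neg hjk, toExt_zero, mul_zero]
      exact W.zero_mem
  | one => exact ⟨0, 0, isPauli_one, fun j => by simp only [Finsupp.zero_apply, toExt_zero]; exact W.zero_mem⟩
  | mul A B _ _ hA hB =>
    obtain ⟨a, b, h, h'⟩ := hA
    obtain ⟨a', b', h2, h2'⟩ := hB
    refine ⟨_, _, h.mul h2, fun j => ?_⟩
    simp only [Finsupp.add_apply, toExt_add]
    exact W.add_mem (h' j) (h2' j)
  | inv A _ hA =>
    obtain ⟨a, b, h, h'⟩ := hA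
    refine ⟨_, _, h.inv, fun j => ?_⟩
    simp only [Finsupp.neg_apply, toExt_neg]
    exact W.neg_mem (h' j)

end Distance

/-! ### Purity and free distance of the stabilizer code -/

section Main

open Matrix

variable {F K : Type*} [Field F] [Fintype F] [Field K] [Algebra F K] {r n i : ℕ}
  {β : K} {e : Fin r ≃ Fin (2 * i) × Fin 2} {S : Matrix (Fin r) (Fin n ⊕ Fin n) F[X]}
  {W : Submodule K (Fin n → K)} {A : Matrix (Fin (2 * i)) (Fin n) K}
  {B : Matrix (Fin 2) (Fin n) K}

theorem SelfOrthogonalRows.coeff_pencil_mem {q : ℕ} (h : SelfOrthogonalRows q i W A B)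
    (s : Fin (2 * i)) (k : ℕ) :
    (fun l => (pencil A (padRows (2 * i) B) s l).coeff k) ∈ W := by
  simp only [coeff_pencil]
  split_ifs with h0 h1
  · exact h.left_mem s
  · by_cases hs : (s : ℕ) < 2
    · simp only [padRows, dif_pos hs]
      exact h.right_mem _
    · simp only [padRows, dif_neg hs]
      exact W.zero_mem
  · exact W.zero_mem

/-- A single nonzero frame is a word of `W`, so it already has weight at least `q² + 2 - q`. -/
theorem isPure_stabilizer (hS : IsExpansion β e S (pencil A (padRows (2 * i) B)))
    (hβ : LinearIndependent F ![β, β ^ Fintype.card F])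
    (h : SelfOrthogonalRows (Fintype.card F) i W A B)
    (hi : 2 * i + 4 ≤ Fintype.card F) : IsPure (stabilizer S) (2 * i + 3) := by
  intro E hE hw
  obtain ⟨a, b, hab, hW⟩ := exists_isPauli_of_mem_stabilizer hS h.coeff_pencil_mem hE
  rw [hab.weight_eq, ncard_toExt hβ] at hw ⊢
  have hne : (Function.support fun k => toExt β (a k) (b k)).Nonempty := by
    rw [Set.nonempty_iff_ne_empty]
    intro h0
    exact hw (by rw [h0, Set.ncard_empty])
  obtain ⟨⟨j, l⟩, hjl⟩ := hne
  have h1 := h.distance _ (hW j) (Function.ne_iff.2 ⟨l, hjl⟩)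
  have h2 := ncard_support_frame_le (finite_support_toExt (β := β) a b) j
  nlinarith

theorem hasFreeDistance_stabilizer (hS : IsExpansion β e S (pencil A (padRows (2 * i) B)))
    (hβ : LinearIndependent F ![β, β ^ Fintype.card F])
    (hβ' : β ^ 2 - (β ^ Fintype.card F) ^ 2 ≠ 0) (hK : Module.finrank F K = 2)
    (hd : ∀ x y, (S x y).natDegree ≤ 1)
    (h : SelfOrthogonalRows (Fintype.card F) i W A B) (hi1 : 1 ≤ i)
    (hi : 2 * i + 4 ≤ Fintype.card F) (hn : 2 * i + 2 < n) :
    HasFreeDistance (stabilizer S) (2 * i + 3) := by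
  constructor
  · intro E hE hw
    obtain ⟨a, b, hab⟩ := exists_isPauli_of_mem_pauliGroup hE
    by_contra hnd
    rw [Detects, not_or] at hnd
    obtain ⟨hcomm, hscal⟩ := hnd
    push Not at hcomm
    rw [forall_commute_iff hab] at hcomm
    rw [hab.weight_eq, ncard_toExt hβ, ← support_pow_card (F := F)] at hw
    refine absurd (h.lt_ncard_support hi1 (u := fun k => toExt β (a k) (b k) ^ Fintype.card F)
      ?_ ?_ ?_) (by omega)
    · rw [support_pow_card]
      exact finite_support_toExt a b
    · intro h0
      have hz : ∀ k, a k = 0 ∧ b k = 0 := fun k => by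
        rw [← toExt_eq_zero_iff hβ]
        exact eq_zero_of_pow_eq_zero (congrFun h0 k)
      obtain rfl : a = 0 := Finsupp.ext fun k => (hz k).1
      obtain rfl : b = 0 := Finsupp.ext fun k => (hz k).2
      exact hscal ⟨1, one_mem _, hab.eq_smul_one⟩
    · intro j s
      refine eq_zero_of_skew_eq_zero hK hβ' fun c => ?_
      have h1 := commForm_eq hS hK hd a b (e.symm (s, c)) j
      rw [hcomm, map_zero, zero_mul] at h1
      simpa only [Equiv.apply_symm_apply] using h1.symm
  -- Orthogonality to `2i + 2` rows is achieved with weight at most `2i + 3`, and the dual distance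
  -- excludes less.
  · obtain ⟨u, hu0, hule, hu⟩ := exists_orthogonal_of_card_lt (Sum.elim A B) (by simpa using hn)
    have hu1 : ∀ s, ∑ l, A s l * u l = 0 := fun s => hu (Sum.inl s)
    have hu2 : ∀ s, ∑ l, B s l * u l = 0 := fun s => hu (Sum.inr s)
    have hcard : (Function.support u).ncard = 2 * i + 3 := by
      have := h.dual u hu0 hu1 hu2
      simp only [Fintype.card_sum, Fintype.card_fin] at hule
      omega
    -- The error sits in frame 0 and is the conjugate of `u`, because the parity checks apply to the
    -- conjugated label.
    choose a b hab using fun l => exists_toExt_eq hβ hK (u l ^ Fintype.card F)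
    set E := pauliX (stream 0 fun l => C (a l)) * pauliZ (stream 0 fun l => C (b l)) with hE
    have hEP := isPauli_mul (stream 0 fun l => C (a l)) (stream 0 fun l => C (b l))
    rw [← hE] at hEP
    have hv0 : ∀ l, toExt β (stream 0 (fun l => C (a l)) (0, l)) (stream 0 (fun l => C (b l)) (0, l))
        = u l ^ Fintype.card F := fun l => by simp [stream_apply, hab]
    have hvj : ∀ j l, j ≠ 0 → toExt β (stream 0 (fun l => C (a l)) (j, l))
        (stream 0 (fun l => C (b l)) (j, l)) = 0 := by
      intro j l hj
      simp only [stream_apply, coeff_C]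
      split_ifs with h1 h2
      · omega
      · exact toExt_zero β
      · exact toExt_zero β
    have hwt : weight E = 2 * i + 3 := by
      rw [hEP.weight_eq, ncard_toExt hβ, ← hcard, ← support_pow_card (F := F) u,
        ← Set.ncard_image_of_injective (Function.support fun l => u l ^ Fintype.card F)
          (Prod.mk_right_injective (0 : ℤ))]
      congr 1
      refine Set.ext fun ⟨j, l⟩ => ?_
      rw [Function.mem_support, Set.mem_image]
      constructor
      · intro hjl
        by_cases hj : j = 0
        · subst hj
          exact ⟨l, by rwa [hv0] at hjl, rfl⟩
        · exact absurd (hvj j l hj) hjl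
      · rintro ⟨l', hl', h2⟩
        obtain ⟨rfl, rfl⟩ := Prod.mk.inj h2
        rw [hv0]
        exact hl'
    refine ⟨E, mul_mem (pauliX_mem _) (pauliZ_mem _), hwt, ?_⟩
    rintro (hnc | ⟨A', hA', c, hc⟩)
    · revert hnc
      rw [imp_false]
      push Not
      rw [forall_commute_iff hEP]
      intro x j
      have h1 := commForm_eq hS hK hd (stream 0 fun l => C (a l)) (stream 0 fun l => C (b l)) x j
      have hT : ∑ l, (A (e x).1 l * toExt β (stream 0 (fun l => C (a l)) (j, l))
          (stream 0 (fun l => C (b l)) (j, l)) ^ Fintype.card F + padRows (2 * i) B (e x).1 l *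
          toExt β (stream 0 (fun l => C (a l)) (j + 1, l))
          (stream 0 (fun l => C (b l)) (j + 1, l)) ^ Fintype.card F) = 0 := by
        rw [Finset.sum_add_distrib]
        have hA0 : ∑ l, A (e x).1 l * toExt β (stream 0 (fun l => C (a l)) (j, l))
            (stream 0 (fun l => C (b l)) (j, l)) ^ Fintype.card F = 0 := by
          by_cases hj : j = 0
          · subst hj
            simp_rw [hv0, pow_card_pow_card hK]
            exact hu1 _
          · simp_rw [hvj j _ hj, zero_pow Fintype.card_ne_zero, mul_zero]
            exact Finset.sum_const_zero
        have hB0 : ∑ l, padRows (2 * i) B (e x).1 l *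
            toExt β (stream 0 (fun l => C (a l)) (j + 1, l))
            (stream 0 (fun l => C (b l)) (j + 1, l)) ^ Fintype.card F = 0 := by
          by_cases hj : j + 1 = 0
          · rw [hj]
            simp_rw [hv0, pow_card_pow_card hK]
            by_cases hx : ((e x).1 : ℕ) < 2
            · simp only [padRows, dif_pos hx]
              exact hu2 _
            · simp only [padRows, dif_neg hx, zero_mul, Finset.sum_const_zero]
          · simp_rw [hvj _ _ hj, zero_pow Fintype.card_ne_zero, mul_zero]
            exact Finset.sum_const_zero
        rw [hA0, hB0, add_zero]
      simp only [hT, zero_pow Fintype.card_ne_zero, mul_zero, sub_zero] at h1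
      simpa [hβ'] using h1
    · obtain ⟨a', b', hab', hW⟩ := exists_isPauli_of_mem_stabilizer hS h.coeff_pencil_mem hA'
      obtain ⟨rfl, rfl⟩ := hEP.eq_of_eq_smul hab' hc
      have hW0 := hW 0
      simp_rw [hv0] at hW0
      -- Were the error in the stabilizer, its frame would be a nonzero word of `W`, too heavy to
      -- have weight `2i + 3`.
      have h1 := h.distance _ hW0 (fun h0 => hu0 (funext fun l =>
        eq_zero_of_pow_eq_zero (congrFun h0 l)))
      rw [support_pow_card, hcard] at h1
      nlinarith

end Main
end
end QConv

/-! ### Assembly of the quantum MDS code -/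

theorem theorem5p2 (t : ℕ) (ht : 3 ≤ t) (q : ℕ) (hq : q = 2 ^ t) (n : ℕ) (hn : n = q ^ 2 + 1)
    (F : Type*) [Field F] [Fintype F] (hF : Fintype.card F = q)
    (K : Type*) [Field K] [Algebra F K] (hK : Module.finrank F K = 2)
    (i : ℕ) (hi : 2 ≤ i) (hi' : i ≤ q / 2 - 2) :
    ∃ S : Matrix (Fin (4 * i)) (Fin n ⊕ Fin n) F[X],
      QConv.IsMDSCode K S (n - 4 * i) 1 2 (2 * i + 3) := by
  have hp : Fact (Nat.Prime 2) := ⟨Nat.prime_two⟩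
  have : Module.Finite F K := Module.finite_of_finrank_pos (by omega)
  have : Finite K := Module.finite_of_finite F
  let _ := Fintype.ofFinite K
  have : CharP F 2 := charP_of_card_eq_prime_pow (f := t) (by rw [hF, hq])
  have : CharP K 2 := charP_of_injective_algebraMap (algebraMap F K).injective 2
  have hq2 : 2 ∣ q := hq ▸ dvd_pow_self 2 (by omega)
  have hiq : 2 * i + 4 ≤ q := by omega
  have hcardK : Fintype.card K = q ^ 2 := by rw [QConv.card_eq_sq hK, hF]
  obtain ⟨W, A, B, h⟩ := QConv.exists_selfOrthogonalRows (K := K) (i := i) hq hcardK (by omega)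
    hiq hq2
  have σ : Fin n ≃ Option K := Fintype.equivOfCardEq (by
    rw [Fintype.card_fin, Fintype.card_option, hcardK, hn])
  replace h := h.reindex σ
  obtain ⟨β, hβ, hβ'⟩ := QConv.exists_linearIndependent_pair hK
  have e : Fin (4 * i) ≃ Fin (2 * i) × Fin 2 := Fintype.equivOfCardEq (by
    rw [Fintype.card_fin, Fintype.card_prod, Fintype.card_fin, Fintype.card_fin]; ring)
  obtain ⟨S, hS⟩ := QConv.exists_isExpansion hβ hK e
    (QConv.pencil (A.submatrix id σ) (QConv.padRows (2 * i) (B.submatrix id σ)))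
  have hconv := QConv.isConvCode_rowCode_pencil (by omega) h.linearIndependent
  have hmem : QConv.memory S = 1 := by
    rw [hS.memory_eq hβ]
    exact QConv.memory_pencil_padRows (by omega) fun r => h.linearIndependent.ne_zero (Sum.inr r)
  have hd : ∀ x y, (S x y).natDegree ≤ 1 := fun x y => hmem ▸ QConv.natDegree_le_memory S x y
  have hn4 : 4 * i + 8 ≤ n := by nlinarith
  subst hF
  refine ⟨S, ⟨by omega, ?_, hmem, ⟨β, hβ, 2 * i, _, by ring, hconv, hS.coe_rowCode hβ hK⟩, ?_⟩,
    QConv.isPure_stabilizer hS hβ h hiq, ?_⟩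
  · exact QConv.isStabilizerMatrix_of_symplectic hd
      (hS.linearIndependent_row hβ (QConv.isBasic_pencil h.linearIndependent))
      (hS.symplectic_eq_zero hK hβ' h.selfOrthogonal h.coeff_pencil_mem)
  · exact QConv.hasFreeDistance_stabilizer hS hβ hβ' hK hd h (by omega) hiq (by omega)
  · have hc : ((n - 4 * i : ℕ) : ℚ) = n - 4 * i := by
      rw [Nat.cast_sub (by omega)]; push_cast; ring
    have hn4' : (4 * i + 8 : ℚ) ≤ n := by exact_mod_cast hn4
    -- Here `2γ = 4` is less than `n + k = 2n - 4i`, so the bound reads `2i + 2 + 1`.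
    have hfl : ⌊2 * ((2 : ℕ) : ℚ) / (n + (n - 4 * i))⌋ = 0 := by
      rw [Int.floor_eq_zero_iff, Set.mem_Ico]
      have hi0 : (0 : ℚ) ≤ i := Nat.cast_nonneg i
      constructor
      · apply div_nonneg <;> push_cast <;> linarith
      · rw [div_lt_one (by linarith)]
        push_cast
        linarith
    rw [QConv.singletonBound, hc, hfl]
    push_cast
    ring
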